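/- Let $\mathbb K\in\{\mathbb R,\mathbb C\}$. Fix a single step scheme: rational functions $r,p_1,\dots,p_m$ over $\mathbb K$ and distinct nodes $c_1,\dots,c_m\in[0,1]$. Assume, for some integer $q\ge 1$: (P1) $|r(-\lambda)|<1$ and $|p_i(-\lambda)|\le B$ for all $\lambda>0$ and all $i$, with some constant $B$, and the numerator of each $p_i$ has lower degree than its denominator; (P2) as $\lambda\to0^+$, $r(-\lambda)=e^{-\lambda}+O(\lambda^{q+1})$ and, for $0\le j\le q$, $\sum_{i=1}^m c_i^j p_i(-\lambda)-\frac{j!}{(-\lambda)^{j+1}}\bigl(e^{-\lambda}-\sum_{\ell=0}^j\frac{(-\lambda)^\ell}{\ell!}\bigr)=O(\lambda^{q-j})$; (P3) $|r(-\infty)|<1$, where $r(-\infty)=\lim_{\lambda\to\infty}r(-\lambda)$. Then there are an integer $J_*>0$ and a constant $C>0$, both depending only on the scheme, $q$ and $\mathbb K$, such that the following holds. Let $H$ be a Hilbert space over $\mathbb K$, $A$ a positive definite self-adjoint operator in $H$ with compact inverse, $T>0$, $u^0\in H$, and $f:[0,T]\to H$ with $f^{(\ell)}\in C([0,T];D(A^{q-\ell}))$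 for $0\le\ell\le q-1$ and $f^{(q)}\in L^1(0,T;H)$. Let $J\ge\max(2,J_*)$ and $N_c\ge1$ be integers, $\Delta t=T/(N_cJ)$, $\Delta T=J\Delta t$, $t_n=n\Delta t$, $T_n=n\Delta T$. Define $$\mathcal G(T_n,\Delta T,v,f)=(I+\Delta T A)^{-1}\bigl(v+\Delta T f(T_n)\bigr),\qquad \mathcal F(t,\Delta t,v,f)=r(-\Delta tA)v+\Delta t\sum_{i=1}^m p_i(-\Delta tA)f(t+c_i\Delta t),$$ where functions of $A$ are taken in the sense of the spectral calculus. Let $u^{n+1}=\mathcal F(t_n,\Delta t,u^n,f)$ for $n\ge0$, starting from $u^0$, be the fine time stepping solution of $u'+Au=f$, $u(0)=u^0$. Let $U_k^n$ be the parareal iterates: $U_k^0=u^0$ for all $k\ge0$, $U_0^{n+1}=\mathcal G(T_n,\Delta T,U_0^n,f)$, and $$U_{k+1}^{n+1}=\mathcal G(T_n,\Delta T,U_{k+1}^n,f)+\widetilde U_k^{n+1}-\mathcal G(T_n,\Delta T,U_k^n,f),$$ where $\widetilde U_k^{n+1}=\widetilde U_k^{n,J}$ is given by $\widetilde U_k^{n,0}=U_k^n$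 and $\widetilde U_k^{n,j+1}=\mathcal F(T_n+j\Delta t,\Delta t,\widetilde U_k^{n,j},f)$ for $0\le j\le J-1$. Then for all $k\ge0$ $$\max_{1\le n\le N_c}\|U_k^n-u^{nJ}\|\le C\Bigl(\|u^0\|+T\Bigl(T\sup_{0\le s\le T}\|Af(s)\|+\int_0^T\|f'(s)\|\,ds\Bigr)\Bigr)\,0.3^k .$$ In particular $u^0$ is an arbitrary element of $H$ and enters only through $\|u^0\|$ (robustness with respect to nonsmooth initial data). -/

import Mathlib

open scoped Topology Nat

noncomputable section

namespace Parareal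

/-! ### Single step schemes -/

/-- A single step scheme
`u^{n+1} = r(-Δt A) u^n + Δt ∑ i, p_i(-Δt A) f(t_n + c_i Δt)`:
rational functions `r`, `p_1, …, p_m` and distinct nodes `c_1, …, c_m` in `[0,1]`.
The coefficients of the rational functions lie in the scalar field of the Hilbert space. -/
structure SingleStepScheme (𝕜 : Type*) [RCLike 𝕜] where
  /-- the number of stages -/
  m : ℕ
  /-- the stability function -/
  r : RatFunc 𝕜
  /-- the weights of the source term -/
  p : Fin m → RatFunc 𝕜
  /-- the nodes -/
  c : Fin m → ℝ
  c_mem : ∀ i, c i ∈ Set.Icc (0 : ℝ) 1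
  c_injective : Function.Injective c

/-- The value of the rational function `ρ` at the real point `x`. `RatFunc.eval` divides the
values of the coprime numerator and denominator. -/
def ratVal {𝕜 : Type*} [RCLike 𝕜] (ρ : RatFunc 𝕜) (x : ℝ) : 𝕜 :=
  ρ.eval (RingHom.id 𝕜) (x : 𝕜)

/-- (P1): `|r(-x)| < 1` and `|p_i(-x)| ≤ B` for all `x > 0`, and the numerator of each `p_i` has
lower degree than its denominator. (A pole on the negative half-line, or at `0`, is excluded by
the bounds at the neighbouring points.) -/
structure SingleStepScheme.P1 {𝕜 : Type*} [RCLike 𝕜] (S : SingleStepScheme 𝕜) : Prop where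
  norm_r_lt_one : ∀ x : ℝ, 0 < x → ‖ratVal S.r (-x)‖ < 1
  norm_p_le : ∃ B : ℝ, ∀ i, ∀ x : ℝ, 0 < x → ‖ratVal (S.p i) (-x)‖ ≤ B
  degree_lt : ∀ i, (S.p i).num.degree < (S.p i).denom.degree

/-- (P2): the scheme is accurate of order `q`. -/
structure SingleStepScheme.P2 {𝕜 : Type*} [RCLike 𝕜] (S : SingleStepScheme 𝕜) (q : ℕ) :
    Prop where
  r_accurate :
    (fun x : ℝ => ratVal S.r (-x) - ((Real.exp (-x) : ℝ) : 𝕜))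
      =O[𝓝[>] (0 : ℝ)] (fun x : ℝ => x ^ (q + 1))
  p_accurate : ∀ j ≤ q,
    (fun x : ℝ => (∑ i, ((S.c i : ℝ) : 𝕜) ^ j * ratVal (S.p i) (-x)) -
        (((j ! : ℝ) / (-x) ^ (j + 1) *
          (Real.exp (-x) - ∑ l ∈ Finset.range (j + 1), (-x) ^ l / (l ! : ℝ)) : ℝ) : 𝕜))
      =O[𝓝[>] (0 : ℝ)] (fun x : ℝ => x ^ (q - j))

/-- (P3): strong stability, `|r(-∞)| < 1`. -/
def SingleStepScheme.P3 {𝕜 : Type*} [RCLike 𝕜] (S : SingleStepScheme 𝕜) : Prop :=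
  ∃ ρ : 𝕜, Filter.Tendsto (fun x : ℝ => ratVal S.r (-x)) Filter.atTop (𝓝 ρ) ∧ ‖ρ‖ < 1

/-! ### The operator `A` -/

section Operator

variable {𝕜 H : Type*} [RCLike 𝕜] [NormedAddCommGroup H] [InnerProductSpace 𝕜 H]

/-- `A` is a positive definite self-adjoint (in particular densely defined) operator with a
compact inverse `K : H → D(A)`. -/
structure IsPosDefCompactInverse [CompleteSpace H] (A : H →ₗ.[𝕜] H) : Prop where
  selfAdjoint : IsSelfAdjoint A
  posDef : ∀ x : A.domain, x ≠ 0 → 0 < RCLike.re (inner 𝕜 (A x) (x : H))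
  compact_inverse : ∃ K : H →L[𝕜] H, IsCompactOperator K ∧
    (∀ y, ∃ hy : K y ∈ A.domain, A ⟨K y, hy⟩ = y) ∧ ∀ x : A.domain, K (A x) = x

open Classical in
/-- `A x` for `x ∈ D(A)`; it is set to `0` off the domain. -/
def app (A : H →ₗ.[𝕜] H) (x : H) : H :=
  if hx : x ∈ A.domain then A ⟨x, hx⟩ else 0

/-- The domain of `A ^ k`; on it, `A ^ k x` is `(app A)^[k] x`. -/
def powDomain (A : H →ₗ.[𝕜] H) (k : ℕ) : Set H :=
  {x | ∀ i < k, (app A)^[i] x ∈ A.domain}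

/-- The eigenspace `{x ∈ D(A) | A x = μ x}` for a real number `μ`. -/
def eigenspace (A : H →ₗ.[𝕜] H) (μ : ℝ) : Submodule 𝕜 H :=
  A.graph.comap (LinearMap.prod LinearMap.id ((μ : 𝕜) • LinearMap.id))

/-- The spectral functional calculus `g(A) v = ∑_μ g(μ) P_μ v`, where `P_μ` is the orthogonal
projection onto the eigenspace of `μ` (so `P_μ = 0` unless `μ` is an eigenvalue). The
eigenspaces of a self-adjoint operator are closed, so the closure below changes nothing; it only
provides the projection for every `A`. For a self-adjoint operator with compact inverse this is
`∑_j g(λ_j) (v, e_j) e_j` for any orthonormal basis of eigenvectors `e_j`, and the series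
converges for all `v` if `g` is bounded on the spectrum. -/
def specMap [CompleteSpace H] (A : H →ₗ.[𝕜] H) (g : ℝ → 𝕜) (v : H) : H :=
  ∑' μ : ℝ, g μ • (eigenspace A μ).topologicalClosure.starProjection v

/-- `(I + τ A)⁻¹ w`: the element `x` of `D(A)` with `x + τ A x = w`. -/
def resolvent (A : H →ₗ.[𝕜] H) (τ : ℝ) (w : H) : H :=
  Classical.epsilon fun x : H => ∃ hx : x ∈ A.domain, x + (τ : 𝕜) • A ⟨x, hx⟩ = w

/-! ### Propagators and the parareal iteration -/

/-- The coarse (backward Euler) propagator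
`G(T_n, ΔT, v, f) = (I + ΔT A)⁻¹ (v + ΔT f(T_n))`. -/
def coarse (A : H →ₗ.[𝕜] H) (Tn ΔT : ℝ) (v : H) (f : ℝ → H) : H :=
  resolvent A ΔT (v + (ΔT : 𝕜) • f Tn)

/-- The fine propagator
`F(t_n, Δt, v, f) = r(-Δt A) v + Δt ∑ i, p_i(-Δt A) f(t_n + c_i Δt)`. -/
def fine [CompleteSpace H] (S : SingleStepScheme 𝕜) (A : H →ₗ.[𝕜] H) (tn Δt : ℝ) (v : H)
    (f : ℝ → H) : H :=
  specMap A (fun μ => ratVal S.r (-(Δt * μ))) v +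
    (Δt : 𝕜) • ∑ i, specMap A (fun μ => ratVal (S.p i) (-(Δt * μ))) (f (tn + S.c i * Δt))

/-- The fine time stepping solution `u^n`, with `t_n = n Δt`. -/
def timeStepping [CompleteSpace H] (S : SingleStepScheme 𝕜) (A : H →ₗ.[𝕜] H) (Δt : ℝ)
    (u₀ : H) (f : ℝ → H) : ℕ → H
  | 0 => u₀
  | n + 1 => fine S A (n * Δt) Δt (timeStepping S A Δt u₀ f n) f

/-- The fine values `Ũ^{n,j}` inside a coarse interval that starts at time `Tn` with value `v`. -/
def fineInner [CompleteSpace H] (S : SingleStepScheme 𝕜) (A : H →ₗ.[𝕜] H) (Tn Δt : ℝ)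
    (v : H) (f : ℝ → H) : ℕ → H
  | 0 => v
  | j + 1 => fine S A (Tn + j * Δt) Δt (fineInner S A Tn Δt v f j) f

/-- The initial guess `U_0^n`, computed by the coarse propagator alone. -/
def initialGuess (A : H →ₗ.[𝕜] H) (ΔT : ℝ) (u₀ : H) (f : ℝ → H) : ℕ → H
  | 0 => u₀
  | n + 1 => coarse A (n * ΔT) ΔT (initialGuess A ΔT u₀ f n) f

/-- One parareal sweep with coarse step `ΔT = J Δt`: from `V n = U_k^n` to `U_{k+1}^n`. -/
def sweep [CompleteSpace H] (S : SingleStepScheme 𝕜) (A : H →ₗ.[𝕜] H) (J : ℕ) (Δt : ℝ)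
    (u₀ : H) (f : ℝ → H) (V : ℕ → H) : ℕ → H
  | 0 => u₀
  | n + 1 =>
      coarse A (n * (J * Δt)) (J * Δt) (sweep S A J Δt u₀ f V n) f
        + fineInner S A (n * (J * Δt)) Δt (V n) f J
        - coarse A (n * (J * Δt)) (J * Δt) (V n) f

/-- The parareal iterates `U_k^n = parareal S A J Δt u₀ f k n`, with `ΔT = J Δt`. -/
def parareal [CompleteSpace H] (S : SingleStepScheme 𝕜) (A : H →ₗ.[𝕜] H) (J : ℕ) (Δt : ℝ)
    (u₀ : H) (f : ℝ → H) : ℕ → ℕ → H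
  | 0 => initialGuess A (J * Δt) u₀ f
  | k + 1 => sweep S A J Δt u₀ f (parareal S A J Δt u₀ f k)

/-! ### Data -/

/-- Regularity of the source term: `df l` represents the derivative `f^{(l)}` on `[0,T]`, with
`f^{(l)} ∈ C([0,T]; D(A^{q-l}))` (graph norm) for `l < q`, and `f^{(q)} ∈ L¹(0,T;H)`. That
`df (l+1)` is the derivative of `df l` is expressed by the fundamental theorem of calculus,
which is a classical derivative for `l + 1 < q` and a weak one for `l + 1 = q`. -/
structure SourceRegularity [NormedSpace ℝ H] (A : H →ₗ.[𝕜] H) (T : ℝ) (q : ℕ)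
    (f : ℝ → H) (df : ℕ → ℝ → H) : Prop where
  zero_eq : ∀ t ∈ Set.Icc 0 T, df 0 t = f t
  mem_powDomain : ∀ l < q, ∀ t ∈ Set.Icc 0 T, df l t ∈ powDomain A (q - l)
  continuousOn : ∀ l < q, ContinuousOn (df l) (Set.Icc 0 T)
  continuousOn_pow : ∀ l < q, ContinuousOn (fun t => (app A)^[q - l] (df l t)) (Set.Icc 0 T)
  integrable_top : IntervalIntegrable (df q) MeasureTheory.volume 0 T
  eq_integral : ∀ l < q, ∀ t ∈ Set.Icc 0 T, df l t = df l 0 + ∫ s in (0 : ℝ)..t, df (l + 1) s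

/-- The size of the data,
`‖u⁰‖ + T (T sup_{0 ≤ s ≤ T} ‖A f(s)‖ + ∫₀ᵀ ‖f'(s)‖ ds)`. No smoothness of `u⁰` enters. -/
def dataSize (A : H →ₗ.[𝕜] H) (T : ℝ) (u₀ : H) (f f' : ℝ → H) : ℝ :=
  ‖u₀‖ + T * (T * sSup ((fun s => ‖app A (f s)‖) '' Set.Icc 0 T) + ∫ s in (0 : ℝ)..T, ‖f' s‖)

end Operator

end Parareal

end

noncomputable section

namespace Parareal

/-! ### Scalar estimates -/

/-! Everything diagonalises in the eigenspaces of `A`. On the eigenspace of `μ`, with `x = Δt μ`, `z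
= J x` and `R = 1 / (1 + z)`, the source cancels from the error, leaving `e_{k+1}^{n+1} = R
e_{k+1}^n + (r(-x)^J - R) e_k^n`. If `|r(-x)^J - R| ≤ 0.3 (1 - R)`, then since `R + (1 - R) = 1` a
sweep multiplies the maximum over `n` by at most 0.3.

That bound (`exists_contraction`) splits at `e^{-z}`. The distance from `e^{-z}` to `R` is at most
0.2995 (1 - R), a statement about one explicit function (`one_sub_le_one_add_mul_exp_neg`). The
distance from `r(-x)^J` to `e^{-z}` is at most 0.0005 (1 - R) for large `J`: by accuracy for small
`x`, by strong stability for the rest.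

For `k = 0` both trajectories are compared with their own homogeneous solution plus the ramp `t_n
f_μ(0)`. The ramps cancel, and the homogeneous parts differ by at most `2 |u_μ|` because both
multipliers are bounded by 1; this is why no smoothness of `u⁰` is needed. The modes are then
recombined by Bessel and Minkowski, completeness of the eigenvectors coming from the spectral
theorem for the compact inverse. -/

theorem cubic_le_exp_neg (w : ℝ) : 1 - w + w ^ 2 / 2 - w ^ 3 / 6 ≤ Real.exp (-w) := by
  -- The derivative of `G` is `-e^w w^3 / 6`, so `G` has its global maximum 1 at 0, for both signs
  -- of `w`.
  set G : ℝ → ℝ := fun w => Real.exp w * (1 - w + w ^ 2 / 2 - w ^ 3 / 6) with hG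
  have hd : ∀ w, HasDerivAt G (Real.exp w * (-(w ^ 3) / 6)) w := by
    intro w
    have h1 : HasDerivAt (fun w : ℝ => 1 - w + w ^ 2 / 2 - w ^ 3 / 6)
        (0 - 1 + (2 * w) / 2 - (3 * w ^ 2) / 6) w := by
      refine HasDerivAt.sub (HasDerivAt.add (HasDerivAt.sub (hasDerivAt_const w 1)
        (hasDerivAt_id w)) ?_) ?_
      · simpa using (hasDerivAt_pow 2 w).div_const 2
      · simpa using (hasDerivAt_pow 3 w).div_const 6
    exact ((Real.hasDerivAt_exp w).mul h1).congr_deriv (by ring)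
  have hc : Continuous G := continuous_iff_continuousAt.2 fun w => (hd w).continuousAt
  have key : G w ≤ 1 := by
    have h0 : G 0 = 1 := by simp [hG]
    rw [← h0]
    rcases le_total 0 w with h | h
    · refine antitoneOn_of_deriv_nonpos (convex_Ici (0 : ℝ)) hc.continuousOn
        (fun x _ => (hd x).differentiableAt.differentiableWithinAt) ?_ Set.self_mem_Ici h h
      intro x hx
      rw [interior_Ici, Set.mem_Ioi] at hx
      rw [(hd x).deriv]
      have := Real.exp_pos x
      have : 0 < x ^ 3 := by positivity
      nlinarith
    · refine monotoneOn_of_deriv_nonneg (convex_Iic (0 : ℝ)) hc.continuousOn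
        (fun x _ => (hd x).differentiableAt.differentiableWithinAt) ?_ h Set.self_mem_Iic h
      intro x hx
      rw [interior_Iic, Set.mem_Iio] at hx
      rw [(hd x).deriv]
      have h1 := Real.exp_pos x
      have : x ^ 3 < 0 := Odd.pow_neg (by decide) hx
      exact mul_nonneg h1.le (by linarith)
  have hp := Real.exp_pos w
  rw [Real.exp_neg, ← one_div, le_div_iff₀ hp]
  simpa [hG, mul_comm] using key

/-- Follows from `(1 + x)(1 - x + x²) = 1 + x³ ≥ 1` and `1 + x ≤ e^x`. -/
theorem exp_neg_le_quadratic {x : ℝ} (hx : 0 ≤ x) : Real.exp (-x) ≤ 1 - x + x ^ 2 := by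
  rw [Real.exp_neg, inv_le_comm₀ (Real.exp_pos _) (by nlinarith)]
  refine le_trans ?_ (Real.add_one_le_exp x)
  rw [inv_le_iff_one_le_mul₀ (by nlinarith)]
  have : 0 ≤ x ^ 3 := by positivity
  nlinarith

/-- The maximum of `(1 - (1 + z) e^{-z}) / z` is about 0.2984, near `z = 1.79`. The slack is so
small that the middle range needs an expansion about 1.8. -/
theorem one_sub_le_one_add_mul_exp_neg {z : ℝ} (hz : 0 ≤ z) :
    1 - 0.2995 * z ≤ (1 + z) * Real.exp (-z) := by
  have hpos := Real.exp_pos (-z)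
  rcases le_total z 0.55 with h | h
  · have h1 := cubic_le_exp_neg z
    have h2 := mul_le_mul_of_nonneg_left h1 (by linarith : 0 ≤ 1 + z)
    have h3 : 0 ≤ z ^ 3 * (2 - z) := by
      have : 0 ≤ 2 - z := by linarith
      positivity
    nlinarith [mul_nonneg hz (sub_nonneg.2 h)]
  rcases le_total z 3.34 with h' | h'
  · obtain ⟨w, rfl⟩ : ∃ w, z = 1.8 + w := ⟨z - 1.8, by ring⟩
    have h1 := cubic_le_exp_neg w
    -- Since `e^{1.8} ≈ 6.0496`, the margin is thin; fifth powers reduce it to `e^9 ≤ 6.05^5`.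
    have h18 : (1 : ℝ) / 6.05 ≤ Real.exp (-1.8) := by
      rw [Real.exp_neg, ← one_div]
      refine one_div_le_one_div_of_le (Real.exp_pos _) ?_
      refine le_of_pow_le_pow_left₀ (n := 5) (by norm_num) (by norm_num) ?_
      rw [← Real.exp_nat_mul]
      have : ((5 : ℕ) : ℝ) * 1.8 = ((9 : ℕ) : ℝ) * 1 := by norm_num
      rw [this, Real.exp_nat_mul]
      calc Real.exp 1 ^ 9 ≤ (2.7182818286 : ℝ) ^ 9 :=
            pow_le_pow_left₀ (Real.exp_pos _).le Real.exp_one_lt_d9.le 9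
        _ ≤ 6.05 ^ 5 := by norm_num
    have hE : Real.exp (-(1.8 + w)) = Real.exp (-1.8) * Real.exp (-w) := by
      rw [← Real.exp_add]; congr 1; ring
    have h2 : 1 / 6.05 * Real.exp (-w) ≤ Real.exp (-(1.8 + w)) := by
      rw [hE]; exact mul_le_mul_of_nonneg_right h18 (Real.exp_pos _).le
    have h3 : (1 + (1.8 + w)) * (1 / 6.05 * (1 - w + w ^ 2 / 2 - w ^ 3 / 6))
        ≤ (1 + (1.8 + w)) * Real.exp (-(1.8 + w)) :=
      mul_le_mul_of_nonneg_left
        ((mul_le_mul_of_nonneg_left h1 (by norm_num)).trans h2) (by linarith)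
    refine le_trans ?_ h3
    -- The factors vanish at the ends of the range: `0.55 = 1.8 - 1.25` and `3.34 = 1.8 + 1.54`.
    have h4 : 0 ≤ w ^ 2 * ((w + 1.25) * (1.54 - w)) :=
      mul_nonneg (sq_nonneg w) (mul_nonneg (by linarith) (by linarith))
    have h5 : 0 ≤ w ^ 2 * (w + 1.25) := mul_nonneg (sq_nonneg w) (by linarith)
    have h6 : 0 ≤ w ^ 2 * (1.54 - w) := mul_nonneg (sq_nonneg w) (by linarith)
    nlinarith [sq_nonneg (w + 0.2), sq_nonneg w]
  -- From 3.34 on, `1 - 0.2995 z` is negative.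
  · have : 0 ≤ (1 + z) * Real.exp (-z) := by positivity
    linarith

theorem norm_pow_sub_pow_le_mul {𝕜 : Type*} [RCLike 𝕜] {a b : 𝕜} {M : ℝ} (hM : 0 ≤ M)
    (ha : ‖a‖ ≤ M) (hb : ‖b‖ ≤ M) (n : ℕ) :
    ‖a ^ (n + 1) - b ^ (n + 1)‖ ≤ (n + 1) * ‖a - b‖ * M ^ n := by
  induction n with
  | zero => simp
  | succ n ih =>
    have e : a ^ (n + 1 + 1) - b ^ (n + 1 + 1)
        = a * (a ^ (n + 1) - b ^ (n + 1)) + (a - b) * b ^ (n + 1) := by ring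
    have h1 : ‖a * (a ^ (n + 1) - b ^ (n + 1))‖ ≤ M * ((n + 1) * ‖a - b‖ * M ^ n) := by
      rw [norm_mul]; gcongr
    have h2 : ‖(a - b) * b ^ (n + 1)‖ ≤ ‖a - b‖ * M ^ (n + 1) := by
      rw [norm_mul, norm_pow]; gcongr
    rw [e]
    refine (norm_add_le _ _).trans ((add_le_add h1 h2).trans (le_of_eq ?_))
    push_cast; ring

/-- Taylor: `32 e^{z/4} ≥ 32 + 8 z + z²`. -/
theorem mul_one_add_mul_exp_le {z : ℝ} (hz : 0 ≤ z) :
    z * (1 + z) * Real.exp (-(z / 4)) ≤ 32 := by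
  have h := Real.quadratic_le_exp_of_nonneg (x := z / 4) (by positivity)
  rw [Real.exp_neg, ← div_eq_mul_inv, div_le_iff₀ (Real.exp_pos _)]
  nlinarith

/-- The local contraction factor of parareal with `J` fine steps per backward Euler step. -/
theorem exists_contraction {𝕜 : Type*} [RCLike 𝕜] {g : ℝ → 𝕜} {C : ℝ} (hC : 0 ≤ C)
    (hacc : ∀ x : ℝ, 0 < x → ‖g x - ((Real.exp (-x) : ℝ) : 𝕜)‖ ≤ C * x ^ 2)
    (hfar : ∀ x₀ : ℝ, 0 < x₀ → ∃ ρ : ℝ, 0 ≤ ρ ∧ ρ < 1 ∧ ∀ x, x₀ ≤ x → ‖g x‖ ≤ ρ) :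
    ∃ Jstar : ℕ, 0 < Jstar ∧ ∀ J : ℕ, 2 ≤ J → Jstar ≤ J → ∀ x : ℝ, 0 < x →
      ‖g x ^ J - (((1 + J * x)⁻¹ : ℝ) : 𝕜)‖ ≤ 0.3 * (J * x / (1 + J * x)) := by
  -- Below `x₀` the quadratic terms satisfy `(C + 1) x² ≤ x / 2`, which gives `|g x| ≤ 1 - x/2 ≤
  -- e^{-x/2}`.
  set x₀ : ℝ := 1 / (2 * (C + 1)) with hx₀
  have hx₀pos : 0 < x₀ := by positivity
  obtain ⟨ρ, hρ0, hρ1, hρ⟩ := hfar x₀ hx₀pos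
  set σ := max ρ (Real.exp (-x₀)) with hσ
  have hσ0 : 0 ≤ σ := hρ0.trans (le_max_left _ _)
  have hσ1 : σ < 1 := max_lt hρ1 (by rw [Real.exp_lt_one_iff]; linarith)
  have hev : ∀ᶠ n : ℕ in Filter.atTop, 2 * σ ^ n < 0.0005 * (x₀ / (1 + x₀)) := by
    have := (tendsto_pow_atTop_nhds_zero_of_lt_one hσ0 hσ1).const_mul 2
    rw [mul_zero] at this
    exact this.eventually_lt_const (by positivity)
  obtain ⟨N, hN⟩ := Filter.eventually_atTop.1 hev
  -- The near-zero estimate ends in `32 C x`, to be absorbed by `0.0005 J x`; hence 64000.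
  obtain ⟨M, hM⟩ := exists_nat_ge (64000 * C)
  refine ⟨max (max N M) 1, by positivity, fun J hJ2 hJ x hx => ?_⟩
  have hJN : N ≤ J := (le_max_left _ _).trans ((le_max_left _ _).trans hJ)
  have hJM : (M : ℝ) ≤ J := by
    exact_mod_cast (le_max_right _ _).trans ((le_max_left _ _).trans hJ)
  have hJ2' : (2 : ℝ) ≤ J := by exact_mod_cast hJ2
  have hJ0 : (0 : ℝ) < J := by linarith
  set z : ℝ := J * x with hz
  have hzpos : 0 < z := by positivity
  have hexp : Real.exp (-z) = Real.exp (-x) ^ J := by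
    rw [← Real.exp_nat_mul]; congr 1; rw [hz]; ring
  have h1 : ‖((Real.exp (-z) : ℝ) : 𝕜) - (((1 + z)⁻¹ : ℝ) : 𝕜)‖ ≤ 0.2995 * (z / (1 + z)) := by
    rw [← RCLike.ofReal_sub, RCLike.norm_ofReal, abs_le]
    have h := one_sub_le_one_add_mul_exp_neg hzpos.le
    have h' : Real.exp (-z) ≤ (1 + z)⁻¹ := by
      rw [Real.exp_neg]
      exact inv_anti₀ (by positivity) (by linarith [Real.add_one_le_exp z])
    have h'' : (1 + z)⁻¹ - 0.2995 * (z / (1 + z)) ≤ Real.exp (-z) := by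
      have : (1 + z)⁻¹ - 0.2995 * (z / (1 + z)) = (1 - 0.2995 * z) / (1 + z) := by
        field_simp
      rw [this, div_le_iff₀ (by positivity)]; linarith
    have : 0 ≤ 0.2995 * (z / (1 + z)) := by positivity
    constructor <;> linarith
  have h2 : ‖g x ^ J - ((Real.exp (-z) : ℝ) : 𝕜)‖ ≤ 0.0005 * (z / (1 + z)) := by
    rcases le_total x x₀ with hxx | hxx
    · have hee := exp_neg_le_quadratic hx.le
      have hE : Real.exp (-x) ≤ Real.exp (-(x / 2)) := Real.exp_le_exp.2 (by linarith)
      have hg : ‖g x‖ ≤ Real.exp (-(x / 2)) := by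
        have a1 : ‖g x‖ ≤ ‖g x - ((Real.exp (-x) : ℝ) : 𝕜)‖ + Real.exp (-x) := by
          have := norm_add_le (g x - ((Real.exp (-x) : ℝ) : 𝕜)) ((Real.exp (-x) : ℝ) : 𝕜)
          rwa [sub_add_cancel, RCLike.norm_ofReal, abs_of_pos (Real.exp_pos _)] at this
        have a2 : (C + 1) * x ≤ 1 / 2 := by
          have : (C + 1) * x ≤ (C + 1) * x₀ := by gcongr
          refine this.trans (le_of_eq ?_)
          rw [hx₀]; field_simp
        have a3 := Real.add_one_le_exp (-(x / 2))
        have a4 := hacc x hx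
        nlinarith
      obtain ⟨n, rfl⟩ : ∃ n, J = n + 1 := ⟨J - 1, by omega⟩
      have hb : ‖((Real.exp (-x) : ℝ) : 𝕜)‖ ≤ Real.exp (-(x / 2)) := by
        rwa [RCLike.norm_ofReal, abs_of_pos (Real.exp_pos _)]
      have a5 := norm_pow_sub_pow_le_mul (Real.exp_pos _).le hg hb n
      have a6 : Real.exp (-(x / 2)) ^ n ≤ Real.exp (-(z / 4)) := by
        rw [← Real.exp_nat_mul]
        -- Uses `J - 1 ≥ J / 2`, that is `J ≥ 2`.
        refine Real.exp_le_exp.2 ?_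
        rw [hz]; push_cast at hJ2' ⊢
        nlinarith
      rw [hexp, RCLike.ofReal_pow]
      refine a5.trans ?_
      have a7 : ((n : ℝ) + 1) * ‖g x - ((Real.exp (-x) : ℝ) : 𝕜)‖ * Real.exp (-(x / 2)) ^ n
          ≤ ((n : ℝ) + 1) * (C * x ^ 2) * Real.exp (-(z / 4)) := by
        gcongr; exact hacc x hx
      refine a7.trans ?_
      have a8 := mul_one_add_mul_exp_le hzpos.le
      rw [mul_div_assoc', le_div_iff₀ (by positivity)]
      have e1 : ((n : ℝ) + 1) * (C * x ^ 2) * Real.exp (-(z / 4)) * (1 + z)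
          = C * x * (z * (1 + z) * Real.exp (-(z / 4))) := by
        rw [hz]; push_cast; ring
      rw [e1]
      calc C * x * (z * (1 + z) * Real.exp (-(z / 4))) ≤ C * x * 32 := by gcongr
        _ = 0.0005 * (64000 * C) * x := by ring
        _ ≤ 0.0005 * (((n + 1 : ℕ) : ℝ)) * x := by gcongr; exact hM.trans hJM
        _ = 0.0005 * z := by rw [hz]; ring
    -- Away from 0 both powers decay geometrically in `J`, while `z / (1 + z)` stays above `x₀ / (1
    -- + x₀)`.
    · have b1 : ‖g x ^ J‖ ≤ σ ^ J := by
        rw [norm_pow]; gcongr; exact (hρ x hxx).trans (le_max_left _ _)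
      have b2 : ‖((Real.exp (-z) : ℝ) : 𝕜)‖ ≤ σ ^ J := by
        rw [RCLike.norm_ofReal, abs_of_pos (Real.exp_pos _), hexp]
        gcongr
        exact (Real.exp_le_exp.2 (by linarith)).trans (le_max_right _ _)
      have b3 := hN J hJN
      have b4 : x₀ / (1 + x₀) ≤ z / (1 + z) := by
        rw [div_le_div_iff₀ (by positivity) (by positivity)]
        have : x₀ ≤ z := by rw [hz]; nlinarith
        nlinarith
      refine (norm_sub_le _ _).trans ?_
      nlinarith
  have := norm_add_le (g x ^ J - ((Real.exp (-z) : ℝ) : 𝕜))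
    (((Real.exp (-z) : ℝ) : 𝕜) - (((1 + z)⁻¹ : ℝ) : 𝕜))
  rw [sub_add_sub_cancel] at this
  linarith

/-- A function that is bounded on `(0, ∞)` and `O(x ^ s)` at `0` is `O(x ^ s')` on all of `(0, ∞)`
for `s' ≤ s`. -/
theorem exists_le_mul_pow {E : Type*} [NormedAddCommGroup E] {g : ℝ → E} {s t : ℕ} (hst : t ≤ s)
    (hO : g =O[𝓝[>] (0 : ℝ)] fun x : ℝ => x ^ s) {B : ℝ} (hB : ∀ x : ℝ, 0 < x → ‖g x‖ ≤ B) :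
    ∃ C : ℝ, 0 ≤ C ∧ ∀ x : ℝ, 0 < x → ‖g x‖ ≤ C * x ^ t := by
  obtain ⟨c, hc, h⟩ := hO.exists_nonneg
  rw [Asymptotics.isBigOWith_iff] at h
  obtain ⟨ε, hε, h⟩ := (mem_nhdsGT_iff_exists_Ioo_subset' (show (0 : ℝ) < 1 by norm_num)).1 h
  have hε : 0 < ε := hε
  have hB0 : 0 ≤ B := (norm_nonneg _).trans (hB 1 one_pos)
  set δ := min (ε / 2) 1
  have hδ : 0 < δ := by positivity
  refine ⟨c + B / δ ^ t, by positivity, fun x hx => ?_⟩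
  rcases le_total x δ with hxd | hxd
  · have h1 : ‖g x‖ ≤ c * ‖x ^ s‖ :=
      h ⟨hx, lt_of_le_of_lt (hxd.trans (min_le_left _ _)) (by linarith)⟩
    rw [Real.norm_of_nonneg (by positivity)] at h1
    have h2 : x ^ s ≤ x ^ t := pow_le_pow_of_le_one hx.le (hxd.trans (min_le_right _ _)) hst
    have h3 : c * x ^ s ≤ c * x ^ t := by gcongr
    have h4 : 0 ≤ B / δ ^ t * x ^ t := by positivity
    rw [add_mul]; linarith
  · have h1 := hB x hx
    have h2 : B ≤ B / δ ^ t * x ^ t := by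
      rw [div_mul_eq_mul_div, le_div_iff₀ (by positivity)]
      gcongr
    have h3 : 0 ≤ c * x ^ t := by positivity
    rw [add_mul]; linarith

/-- The limit controls a neighbourhood of infinity; on the compact remainder the strict bound is
attained, hence uniform. -/
theorem exists_uniform_bound {E : Type*} [NormedAddCommGroup E] {g : ℝ → E}
    (hc : ContinuousOn g (Set.Ioi 0)) (h1 : ∀ x : ℝ, 0 < x → ‖g x‖ < 1) {ℓ : E}
    (hl : Filter.Tendsto g Filter.atTop (𝓝 ℓ)) (hl1 : ‖ℓ‖ < 1) (x₀ : ℝ) (hx₀ : 0 < x₀) :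
    ∃ ρ : ℝ, 0 ≤ ρ ∧ ρ < 1 ∧ ∀ x, x₀ ≤ x → ‖g x‖ ≤ ρ := by
  obtain ⟨b, hb1, hb2⟩ := exists_between hl1
  obtain ⟨X, hX⟩ := Filter.eventually_atTop.1 (hl.norm.eventually_lt_const hb1)
  have hsub : Set.Icc x₀ (max x₀ X) ⊆ Set.Ioi 0 := fun x hx => lt_of_lt_of_le hx₀ hx.1
  obtain ⟨y, hy, hmax⟩ := isCompact_Icc.exists_isMaxOn (Set.nonempty_Icc.2 (le_max_left x₀ X))
    (hc.mono hsub).norm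
  refine ⟨max b ‖g y‖, (norm_nonneg _).trans (le_max_right _ _), max_lt hb2 (h1 y (hsub hy)),
    fun x hx => ?_⟩
  rcases le_total x (max x₀ X) with h | h
  · exact (hmax ⟨hx, h⟩).trans (le_max_right _ _)
  · exact (hX x ((le_max_right _ _).trans h)).le.trans (le_max_left _ _)

/-! ### Absence of poles on the negative half-line -/

section RationalFunctions

variable {𝕜 : Type*} [RCLike 𝕜]

theorem ratVal_eq_div (ρ : RatFunc 𝕜) (x : ℝ) :
    ratVal ρ x = ρ.num.eval (x : 𝕜) / ρ.denom.eval (x : 𝕜) := by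
  simp [ratVal, RatFunc.eval, Polynomial.eval₂_id]

/-- At a pole `ratVal` takes the value 0 by division by zero, so the bound there says nothing. The
bound at nearby points gives `|num| ≤ B |denom|`, which passes to the limit and makes both vanish,
against coprimality. -/
theorem denom_eval_ne_zero_of_bounded {ρ : RatFunc 𝕜} {B : ℝ}
    (hB : ∀ x : ℝ, 0 < x → ‖ratVal ρ (-x)‖ ≤ B) {a : ℝ} (ha : 0 < a) :
    ρ.denom.eval ((-a : ℝ) : 𝕜) ≠ 0 := by
  intro h0
  have hcoe : Continuous fun x : ℝ => ((-x : ℝ) : 𝕜) := RCLike.continuous_ofReal.comp continuous_neg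
  have hcd : Continuous fun x : ℝ => ρ.denom.eval ((-x : ℝ) : 𝕜) := ρ.denom.continuous.comp hcoe
  have hcn : Continuous fun x : ℝ => ρ.num.eval ((-x : ℝ) : 𝕜) := ρ.num.continuous.comp hcoe
  have hne : ∀ᶠ x in 𝓝[≠] a, ρ.denom.eval ((-x : ℝ) : 𝕜) ≠ 0 := by
    have hfin : {x : ℝ | ρ.denom.eval ((-x : ℝ) : 𝕜) = 0}.Finite := by
      refine Set.Finite.preimage (f := fun x : ℝ => ((-x : ℝ) : 𝕜))
        (s := {y : 𝕜 | ρ.denom.IsRoot y}) ?_ (Polynomial.finite_setOfPred_isRoot ρ.denom_ne_zero)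
      intro x _ y _ hxy
      exact neg_injective (RCLike.ofReal_injective hxy)
    have := (hfin.subset Set.sdiff_subset : ({x : ℝ | ρ.denom.eval ((-x : ℝ) : 𝕜) = 0} \ {a}).Finite
      ).isClosed.isOpen_compl.mem_nhds (x := a) (by simp)
    filter_upwards [mem_nhdsWithin_of_mem_nhds this, self_mem_nhdsWithin] with x hx hxa h
    exact hx ⟨h, hxa⟩
  have hle : ∀ᶠ x in 𝓝[≠] a,
      ‖ρ.num.eval ((-x : ℝ) : 𝕜)‖ ≤ B * ‖ρ.denom.eval ((-x : ℝ) : 𝕜)‖ := by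
    filter_upwards [hne, mem_nhdsWithin_of_mem_nhds (Ioi_mem_nhds ha)] with x hx hxa
    have := hB x hxa
    rwa [ratVal_eq_div, norm_div, div_le_iff₀ (norm_pos_iff.2 hx)] at this
  have hlim := le_of_tendsto_of_tendsto (hcn.norm.tendsto a |>.mono_left nhdsWithin_le_nhds)
    ((hcd.norm.tendsto a |>.mono_left nhdsWithin_le_nhds).const_mul B) hle
  rw [h0, norm_zero, mul_zero] at hlim
  have hn0 : ρ.num.eval ((-a : ℝ) : 𝕜) = 0 := norm_le_zero_iff.1 hlim
  obtain ⟨u, v, huv⟩ := ρ.isCoprime_num_denom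
  have := congrArg (Polynomial.eval ((-a : ℝ) : 𝕜)) huv
  simp only [Polynomial.eval_add, Polynomial.eval_mul, hn0, h0, mul_zero, add_zero,
    Polynomial.eval_one] at this
  exact zero_ne_one this

theorem continuousOn_ratVal_neg {ρ : RatFunc 𝕜} {B : ℝ}
    (hB : ∀ x : ℝ, 0 < x → ‖ratVal ρ (-x)‖ ≤ B) :
    ContinuousOn (fun x : ℝ => ratVal ρ (-x)) (Set.Ioi 0) := by
  have hcoe : Continuous fun x : ℝ => ((-x : ℝ) : 𝕜) := RCLike.continuous_ofReal.comp continuous_neg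
  simp only [ratVal_eq_div]
  exact (ρ.num.continuous.comp hcoe).continuousOn.div (ρ.denom.continuous.comp hcoe).continuousOn
    fun x hx => denom_eval_ne_zero_of_bounded hB hx

end RationalFunctions

/-! ### First-order consequences of the scheme conditions -/

section SchemeBounds

variable {𝕜 : Type*} [RCLike 𝕜] {S : SingleStepScheme 𝕜} {q : ℕ}

theorem SingleStepScheme.exists_accuracy_r (hq : 1 ≤ q) (h1 : S.P1) (h2 : S.P2 q) :
    ∃ C : ℝ, 0 ≤ C ∧ ∀ x : ℝ, 0 < x →
      ‖ratVal S.r (-x) - ((Real.exp (-x) : ℝ) : 𝕜)‖ ≤ C * x ^ 2 := by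
  refine exists_le_mul_pow (by omega) h2.r_accurate (B := 1 + 1) fun x hx => ?_
  refine (norm_sub_le _ _).trans (add_le_add (h1.norm_r_lt_one x hx).le ?_)
  rw [RCLike.norm_ofReal, abs_of_pos (Real.exp_pos _), Real.exp_le_one_iff]
  linarith

theorem SingleStepScheme.exists_contraction (hq : 1 ≤ q) (h1 : S.P1) (h2 : S.P2 q) (h3 : S.P3) :
    ∃ Jstar : ℕ, 0 < Jstar ∧ ∀ J : ℕ, 2 ≤ J → Jstar ≤ J → ∀ x : ℝ, 0 < x →
      ‖ratVal S.r (-x) ^ J - (((1 + J * x)⁻¹ : ℝ) : 𝕜)‖ ≤ 0.3 * (J * x / (1 + J * x)) := by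
  obtain ⟨C, hC, hacc⟩ := S.exists_accuracy_r hq h1 h2
  obtain ⟨ℓ, hl, hl1⟩ := h3
  exact Parareal.exists_contraction hC hacc (exists_uniform_bound
    (continuousOn_ratVal_neg fun x hx => (h1.norm_r_lt_one x hx).le) h1.norm_r_lt_one hl hl1)

theorem abs_exp_neg_sub_one_le {x : ℝ} (hx : 0 ≤ x) : |Real.exp (-x) - 1| ≤ x := by
  have h1 := Real.add_one_le_exp (-x)
  have h2 : Real.exp (-x) ≤ 1 := Real.exp_le_one_iff.2 (by linarith)
  rw [abs_le]; constructor <;> linarith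

theorem SingleStepScheme.exists_norm_r_sub_one_le (hq : 1 ≤ q) (h1 : S.P1) (h2 : S.P2 q) :
    ∃ C : ℝ, 0 ≤ C ∧ ∀ x : ℝ, 0 < x → ‖ratVal S.r (-x) - 1‖ ≤ C * x := by
  obtain ⟨C, hC, hacc⟩ := S.exists_accuracy_r hq h1 h2
  refine ⟨max 2 (C + 1), by positivity, fun x hx => ?_⟩
  rcases le_total x 1 with h | h
  · have e := norm_add_le (ratVal S.r (-x) - ((Real.exp (-x) : ℝ) : 𝕜))
      (((Real.exp (-x) - 1 : ℝ) : 𝕜))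
    rw [RCLike.ofReal_sub, RCLike.ofReal_one, sub_add_sub_cancel, ← RCLike.ofReal_one,
      ← RCLike.ofReal_sub, RCLike.norm_ofReal, RCLike.ofReal_one] at e
    have h2 := hacc x hx
    have h3 := abs_exp_neg_sub_one_le hx.le
    have h4 : (C + 1) * x ≤ max 2 (C + 1) * x := by gcongr; exact le_max_right _ _
    have h5 : C * x ^ 2 ≤ C * x := by
      refine mul_le_mul_of_nonneg_left ?_ hC; nlinarith
    linarith
  · have e := norm_sub_le (ratVal S.r (-x)) 1
    have := h1.norm_r_lt_one x hx
    rw [norm_one] at e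
    have h4 : 2 * x ≤ max 2 (C + 1) * x := by gcongr; exact le_max_left _ _
    linarith

/-- The accuracy condition for `j = 0` compares the sum with `(1 - e^{-x}) / x`, which is `1 +
O(x)`; boundedness of the `p_i` extends the estimate to all `x > 0`. -/
theorem SingleStepScheme.exists_norm_sum_p_sub_one_le (hq : 1 ≤ q) (h1 : S.P1) (h2 : S.P2 q) :
    ∃ C : ℝ, 0 ≤ C ∧ ∀ x : ℝ, 0 < x → ‖(∑ i, ratVal (S.p i) (-x)) - 1‖ ≤ C * x := by
  obtain ⟨B, hB⟩ := h1.norm_p_le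
  have hacc := h2.p_accurate 0 (Nat.zero_le _)
  have hphi : ∀ x : ℝ, 0 < x → |(1 - Real.exp (-x)) / x - 1| ≤ x := by
    intro x hx
    have e : (1 - Real.exp (-x)) / x - 1 = (1 - x - Real.exp (-x)) / x := by
      field_simp; ring
    have hee := exp_neg_le_quadratic hx.le
    have h := Real.add_one_le_exp (-x)
    rw [e, abs_div, abs_of_pos hx, div_le_iff₀ hx, abs_le]
    constructor <;> nlinarith
  have hO : (fun x : ℝ => (∑ i, ratVal (S.p i) (-x)) - 1) =O[𝓝[>] (0 : ℝ)] fun x : ℝ => x ^ 1 := by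
    have hO1 : (fun x : ℝ => (((1 - Real.exp (-x)) / x - 1 : ℝ) : 𝕜))
        =O[𝓝[>] (0 : ℝ)] fun x : ℝ => x ^ 1 := by
      refine Asymptotics.IsBigO.of_bound 1 ?_
      filter_upwards [self_mem_nhdsWithin] with x hx
      have hx : 0 < x := hx
      rw [RCLike.norm_ofReal, pow_one, one_mul, Real.norm_of_nonneg hx.le]
      exact hphi x hx
    have hpow : (fun x : ℝ => x ^ (q - 0)) =O[𝓝[>] (0 : ℝ)] fun x : ℝ => x ^ 1 := by
      refine Asymptotics.IsBigO.of_bound 1 ?_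
      filter_upwards [Ioo_mem_nhdsGT (zero_lt_one' ℝ)] with x hx
      have h0 : 0 ≤ x := hx.1.le
      rw [one_mul, Real.norm_of_nonneg (by positivity), Real.norm_of_nonneg (by positivity)]
      exact pow_le_pow_of_le_one h0 hx.2.le (by simpa using hq)
    refine ((hacc.trans hpow).add hO1).congr' ?_ Filter.EventuallyEq.rfl
    filter_upwards [self_mem_nhdsWithin] with x hx
    have hx : x ≠ 0 := (ne_of_gt hx)
    have e : ((0 ! : ℕ) : ℝ) / (-x) ^ (0 + 1) *
        (Real.exp (-x) - ∑ l ∈ Finset.range (0 + 1), (-x) ^ l / (l ! : ℝ))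
          = (1 - Real.exp (-x)) / x := by
      simp; field_simp; ring
    rw [e]
    simp
  obtain ⟨C, hC, h⟩ := exists_le_mul_pow le_rfl hO (B := S.m * B + 1) fun x hx => by
    refine (norm_sub_le _ _).trans (add_le_add ?_ norm_one.le)
    refine (norm_sum_le _ _).trans ((Finset.sum_le_sum fun i _ => hB i x hx).trans ?_)
    simp
  exact ⟨C, hC, fun x hx => by simpa using h x hx⟩

end SchemeBounds

/-! ### Spectral decomposition of an operator with compact inverse -/

section Spectral

variable {𝕜 H : Type*} [RCLike 𝕜] [NormedAddCommGroup H] [InnerProductSpace 𝕜 H]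

theorem mem_eigenspace_iff {A : H →ₗ.[𝕜] H} {μ : ℝ} {x : H} :
    x ∈ eigenspace A μ ↔ ∃ hx : x ∈ A.domain, A ⟨x, hx⟩ = (μ : 𝕜) • x := by
  simp [eigenspace, LinearPMap.mem_graph_iff]

variable [CompleteSpace H]

/-- The orthogonal projection onto the closure of the eigenspace of `μ`. -/
def specProj (A : H →ₗ.[𝕜] H) (μ : ℝ) : H →L[𝕜] H :=
  (eigenspace A μ).topologicalClosure.starProjection

variable {A : H →ₗ.[𝕜] H}

namespace IsPosDefCompactInverse

theorem inner_map_eq (hA : IsPosDefCompactInverse A) (x y : A.domain) :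
    inner 𝕜 (A x) (y : H) = inner 𝕜 (x : H) (A y) := by
  have h := A.adjoint_isFormalAdjoint hA.selfAdjoint.dense_domain
  have e : A.adjoint = A := hA.selfAdjoint
  rw [e] at h
  exact h x y

theorem topologicalClosure_eigenspace (hA : IsPosDefCompactInverse A) (μ : ℝ) :
    (eigenspace A μ).topologicalClosure = eigenspace A μ := by
  refine IsClosed.submodule_topologicalClosure_eq ?_
  have hc : IsClosed (A.graph : Set (H × H)) := hA.selfAdjoint.isClosed
  exact hc.preimage (f := fun x : H => (x, (μ : 𝕜) • x)) (by fun_prop)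

theorem specProj_mem (hA : IsPosDefCompactInverse A) (μ : ℝ) (v : H) :
    specProj A μ v ∈ eigenspace A μ := by
  exact (hA.topologicalClosure_eigenspace μ).le (Submodule.starProjection_apply_mem _ v)

theorem specProj_of_mem (hA : IsPosDefCompactInverse A) {μ : ℝ} {v : H}
    (hv : v ∈ eigenspace A μ) : specProj A μ v = v := by
  rw [specProj, Submodule.starProjection_eq_self_iff, hA.topologicalClosure_eigenspace]
  exact hv

theorem inner_specProj (hA : IsPosDefCompactInverse A) {μ : ℝ} {y : H}
    (hy : y ∈ eigenspace A μ) (v : H) : inner 𝕜 y (specProj A μ v) = inner 𝕜 y v := by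
  rw [specProj, ← Submodule.inner_starProjection_left_eq_right]
  change inner 𝕜 (specProj A μ y) v = _
  rw [hA.specProj_of_mem hy]

theorem specProj_eq_of_inner (hA : IsPosDefCompactInverse A) {μ : ℝ} {v w : H}
    (h : ∀ y ∈ eigenspace A μ, inner 𝕜 y v = inner 𝕜 y w) : specProj A μ v = specProj A μ w := by
  rw [← sub_eq_zero, ← map_sub, ← inner_self_eq_zero (𝕜 := 𝕜), hA.inner_specProj
    (hA.specProj_mem μ _), inner_sub_right, h _ (hA.specProj_mem μ _), sub_self]

theorem eq_zero_of_mem_eigenspace (hA : IsPosDefCompactInverse A) {μ : ℝ} (hμ : μ ≤ 0) {x : H}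
    (hx : x ∈ eigenspace A μ) : x = 0 := by
  by_contra h0
  obtain ⟨hd, hx⟩ := mem_eigenspace_iff.1 hx
  have h := hA.posDef ⟨x, hd⟩ fun h => h0 (congrArg Subtype.val h)
  rw [hx, inner_smul_left, RCLike.conj_ofReal, RCLike.re_ofReal_mul] at h
  have h' : 0 ≤ RCLike.re (inner 𝕜 x x) := inner_self_nonneg
  nlinarith

theorem specProj_eq_zero (hA : IsPosDefCompactInverse A) {μ : ℝ} (hμ : μ ≤ 0) (v : H) :
    specProj A μ v = 0 :=
  hA.eq_zero_of_mem_eigenspace hμ (hA.specProj_mem μ v)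

theorem inner_eq_zero_of_ne (hA : IsPosDefCompactInverse A) {μ ν : ℝ} (h : μ ≠ ν) {x y : H}
    (hx : x ∈ eigenspace A μ) (hy : y ∈ eigenspace A ν) : inner 𝕜 x y = 0 := by
  obtain ⟨hxd, hx⟩ := mem_eigenspace_iff.1 hx
  obtain ⟨hyd, hy⟩ := mem_eigenspace_iff.1 hy
  have e := hA.inner_map_eq ⟨x, hxd⟩ ⟨y, hyd⟩
  rw [hx, hy, inner_smul_left, inner_smul_right, RCLike.conj_ofReal] at e
  have h' : ((μ : 𝕜) - (ν : 𝕜)) ≠ 0 := by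
    rw [sub_ne_zero]; exact fun hc => h (RCLike.ofReal_injective hc)
  have : ((μ : 𝕜) - (ν : 𝕜)) * inner 𝕜 x y = 0 := by rw [sub_mul]; exact sub_eq_zero.2 e
  exact (mul_eq_zero.1 this).resolve_left h'

theorem orthogonalFamily (hA : IsPosDefCompactInverse A) :
    OrthogonalFamily 𝕜 (fun μ : ℝ => eigenspace A μ) fun μ => (eigenspace A μ).subtypeₗᵢ :=
  fun _ _ h x y => hA.inner_eq_zero_of_ne h x.2 y.2

theorem norm_sq_sum (hA : IsPosDefCompactInverse A) {w : ℝ → H}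
    (hw : ∀ μ, w μ ∈ eigenspace A μ) (s : Finset ℝ) :
    ‖∑ μ ∈ s, w μ‖ ^ 2 = ∑ μ ∈ s, ‖w μ‖ ^ 2 :=
  hA.orthogonalFamily.norm_sum (fun μ => ⟨w μ, hw μ⟩) s

/-- Bessel's inequality for the spectral projections. -/
theorem sum_norm_sq_specProj_le (hA : IsPosDefCompactInverse A) (v : H) (s : Finset ℝ) :
    ∑ μ ∈ s, ‖specProj A μ v‖ ^ 2 ≤ ‖v‖ ^ 2 := by
  set w := ∑ μ ∈ s, specProj A μ v with hw
  have h1 : ‖w‖ ^ 2 = ∑ μ ∈ s, ‖specProj A μ v‖ ^ 2 := hA.norm_sq_sum (hA.specProj_mem · v) s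
  have h2 : (inner 𝕜 w v : 𝕜) = ((‖w‖ ^ 2 : ℝ) : 𝕜) := by
    rw [h1, hw, sum_inner, RCLike.ofReal_sum]
    refine Finset.sum_congr rfl fun μ _ => ?_
    rw [← hA.inner_specProj (hA.specProj_mem μ v), inner_self_eq_norm_sq_to_K, RCLike.ofReal_pow]
  have h3 := norm_inner_le_norm (𝕜 := 𝕜) w v
  rw [h2, RCLike.norm_ofReal, abs_of_nonneg (sq_nonneg _)] at h3
  rw [← h1]
  have h4 : ‖w‖ ≤ ‖v‖ := by
    rcases (norm_nonneg w).eq_or_lt with h | h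
    · rw [← h]; exact norm_nonneg v
    · nlinarith
  gcongr

theorem summable_specMap (hA : IsPosDefCompactInverse A) {g : ℝ → 𝕜} {B : ℝ}
    (hg : ∀ μ : ℝ, 0 < μ → ‖g μ‖ ≤ B) (v : H) : Summable fun μ : ℝ => g μ • specProj A μ v := by
  have hf : ∀ μ, g μ • specProj A μ v ∈ eigenspace A μ :=
    fun μ => Submodule.smul_mem _ _ (hA.specProj_mem μ v)
  refine (hA.orthogonalFamily.summable_iff_norm_sq_summable fun μ => ⟨_, hf μ⟩).2 ?_
  have hs : Summable fun μ : ℝ => ‖specProj A μ v‖ ^ 2 :=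
    summable_of_sum_le (fun _ => sq_nonneg _) (hA.sum_norm_sq_specProj_le v)
  refine Summable.of_nonneg_of_le (fun _ => sq_nonneg _) (fun μ => ?_) (hs.mul_left (B ^ 2))
  change ‖g μ • specProj A μ v‖ ^ 2 ≤ _
  rw [norm_smul, mul_pow]
  rcases le_or_gt μ 0 with h | h
  · simp [hA.specProj_eq_zero h]
  · gcongr; exact hg μ h

theorem specProj_specMap (hA : IsPosDefCompactInverse A) {g : ℝ → 𝕜} {B : ℝ}
    (hg : ∀ μ : ℝ, 0 < μ → ‖g μ‖ ≤ B) (v : H) (ν : ℝ) :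
    specProj A ν (specMap A g v) = g ν • specProj A ν v := by
  have hs := hA.summable_specMap hg v
  change specProj A ν (∑' μ, g μ • specProj A μ v) = _
  rw [(specProj A ν).map_tsum hs, tsum_eq_single ν]
  · rw [map_smul, hA.specProj_of_mem (hA.specProj_mem ν v)]
  · intro μ hμ
    rw [map_smul]
    have : specProj A ν (specProj A μ v) = specProj A ν 0 := by
      refine hA.specProj_eq_of_inner fun y hy => ?_
      rw [inner_zero_right, hA.inner_eq_zero_of_ne hμ.symm hy (hA.specProj_mem μ v)]
    rw [this, map_zero, smul_zero]

theorem specProj_map (hA : IsPosDefCompactInverse A) (μ : ℝ) (x : A.domain) :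
    specProj A μ (A x) = (μ : 𝕜) • specProj A μ (x : H) := by
  rw [← map_smul]
  refine hA.specProj_eq_of_inner fun y hy => ?_
  obtain ⟨hd, hy⟩ := mem_eigenspace_iff.1 hy
  rw [← hA.inner_map_eq ⟨y, hd⟩ x, hy, inner_smul_left, inner_smul_right, RCLike.conj_ofReal]

theorem inner_inverse (hA : IsPosDefCompactInverse A) {K : H →L[𝕜] H}
    (hK : ∀ y, ∃ hy : K y ∈ A.domain, A ⟨K y, hy⟩ = y) (x y : H) :
    inner 𝕜 (K x) y = inner 𝕜 x (K y) := by
  obtain ⟨hx, hx'⟩ := hK x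
  obtain ⟨hy, hy'⟩ := hK y
  have := hA.inner_map_eq ⟨K x, hx⟩ ⟨K y, hy⟩
  rw [hx', hy'] at this
  exact this.symm

theorem re_inner_inverse_nonneg (hA : IsPosDefCompactInverse A) {K : H →L[𝕜] H}
    (hK : ∀ y, ∃ hy : K y ∈ A.domain, A ⟨K y, hy⟩ = y) (x : H) :
    0 ≤ RCLike.re (inner 𝕜 (K x) x) := by
  obtain ⟨hx, hx'⟩ := hK x
  by_cases h0 : K x = 0
  · simp [h0]
  have := hA.posDef ⟨K x, hx⟩ fun h => h0 (congrArg Subtype.val h)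
  rw [hx'] at this
  rw [hA.inner_inverse hK]
  exact this.le

/-- The eigenvectors are total. -/
theorem eq_zero_of_specProj_eq_zero (hA : IsPosDefCompactInverse A) {x : H}
    (hx : ∀ μ, specProj A μ x = 0) : x = 0 := by
  obtain ⟨K, hKc, hK, -⟩ := hA.compact_inverse
  have hKs : (K : H →ₗ[𝕜] H).IsSymmetric := fun x y => hA.inner_inverse hK x y
  have htop := ContinuousLinearMap.orthogonalComplement_iSup_eigenspaces_eq_bot hKc hKs
  rw [← Submodule.mem_bot 𝕜, ← htop, ← Submodule.iInf_orthogonal, Submodule.mem_iInf]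
  intro κ y hy
  rw [Module.End.mem_eigenspace_iff] at hy
  by_cases hy0 : y = 0
  · simp [hy0]
  have hy : K y = κ • y := hy
  obtain ⟨hd, hd'⟩ := hK y
  -- The kernel of `K` is trivial because `A (K y) = y`.
  have hκ : κ ≠ 0 := by
    rintro rfl
    rw [zero_smul] at hy
    refine hy0 ?_
    rw [← hd', ← LinearPMap.map_zero A]
    congr 1
    exact Subtype.ext hy
  have hreal : (starRingEnd 𝕜) κ = κ := hKs.conj_eigenvalue_eq_self
    (Module.End.hasEigenvalue_of_hasEigenvector
      ⟨Module.End.mem_eigenspace_iff.2 hy, hy0⟩)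
  obtain ⟨t, rfl⟩ := RCLike.conj_eq_iff_real.1 hreal
  have hyd : y ∈ A.domain := by
    have := A.domain.smul_mem ((t : 𝕜)⁻¹) hd
    rwa [hy, smul_smul, inv_mul_cancel₀ hκ, one_smul] at this
  -- An eigenvector of `K` for `t` is one of `A` for `1 / t`, so `x` is orthogonal to it.
  have hmem : y ∈ eigenspace A t⁻¹ := by
    refine mem_eigenspace_iff.2 ⟨hyd, ?_⟩
    have e : (⟨K y, hd⟩ : A.domain) = (t : 𝕜) • ⟨y, hyd⟩ := Subtype.ext hy
    rw [e, LinearPMap.map_smul] at hd'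
    rw [RCLike.ofReal_inv]
    conv_rhs => rw [← hd', smul_smul, inv_mul_cancel₀ hκ, one_smul]
  rw [← hA.inner_specProj hmem, hx, inner_zero_right]

theorem specMap_one (hA : IsPosDefCompactInverse A) (x : H) :
    specMap A (fun _ => (1 : 𝕜)) x = x := by
  rw [← sub_eq_zero]
  refine hA.eq_zero_of_specProj_eq_zero fun μ => ?_
  rw [map_sub, hA.specProj_specMap (B := 1) (fun _ _ => norm_one.le), one_smul, sub_self]

/-- Completeness turns uniform bounds on finite sums of modes into a norm bound; this is how
modewise estimates return to `H`. -/
theorem norm_le_of_sum_le (hA : IsPosDefCompactInverse A) {x : H} {M : ℝ} (hM : 0 ≤ M)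
    (h : ∀ s : Finset ℝ, ∑ μ ∈ s, ‖specProj A μ x‖ ^ 2 ≤ M ^ 2) : ‖x‖ ≤ M := by
  have hs := (hA.summable_specMap (g := fun _ => (1 : 𝕜)) (B := 1) (fun _ _ => norm_one.le)
    x).hasSum
  have e : ∑' μ : ℝ, (1 : 𝕜) • specProj A μ x = x := hA.specMap_one x
  rw [e] at hs
  refine le_of_tendsto hs.norm (Filter.Eventually.of_forall fun s => ?_)
  refine le_of_sq_le_sq ?_ hM
  simp only [one_smul]
  rw [hA.norm_sq_sum (hA.specProj_mem · x)]
  exact h s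

/-- Writing `x = K y` turns the equation into `(K + τ) y = w`, and `K + τ` is bounded and coercive
because `K` is nonnegative. -/
theorem exists_resolvent (hA : IsPosDefCompactInverse A) {τ : ℝ} (hτ : 0 < τ) (w : H) :
    ∃ x : H, ∃ hx : x ∈ A.domain, x + (τ : 𝕜) • A ⟨x, hx⟩ = w := by
  obtain ⟨K, -, hK, -⟩ := hA.compact_inverse
  have hunit : IsUnit (K + (τ : 𝕜) • ContinuousLinearMap.id 𝕜 H) := by
    refine ContinuousLinearMap.isUnit_of_forall_le_norm_inner_map _ (c := ⟨τ, hτ.le⟩) hτ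
      fun x => ?_
    refine le_trans ?_ (RCLike.re_le_norm _)
    simp only [add_apply, smul_apply,
      ContinuousLinearMap.id_apply, inner_add_left, inner_smul_left, RCLike.conj_ofReal, map_add,
      RCLike.re_ofReal_mul, inner_self_eq_norm_sq]
    have := hA.re_inner_inverse_nonneg hK x
    change ‖x‖ ^ 2 * τ ≤ _
    linarith
  obtain ⟨y, hy⟩ := (ContinuousLinearMap.isUnit_iff_bijective.1 hunit).2 w
  obtain ⟨hd, hd'⟩ := hK y
  refine ⟨K y, hd, ?_⟩
  rw [hd']
  simpa using hy

theorem specProj_resolvent (hA : IsPosDefCompactInverse A) {τ : ℝ} (hτ : 0 < τ) (w : H) {μ : ℝ}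
    (hμ : 0 < μ) :
    specProj A μ (resolvent A τ w) = (((1 + τ * μ)⁻¹ : ℝ) : 𝕜) • specProj A μ w := by
  -- Any solution has the stated components, so the choice made by `epsilon` is immaterial.
  obtain ⟨hd, h⟩ := Classical.epsilon_spec (hA.exists_resolvent hτ w)
  change resolvent A τ w ∈ A.domain at hd
  change resolvent A τ w + (τ : 𝕜) • A ⟨resolvent A τ w, hd⟩ = w at h
  have h' := congrArg (specProj A μ) h
  rw [map_add, map_smul, hA.specProj_map, smul_smul] at h'
  have e : specProj A μ w = ((1 + τ * μ : ℝ) : 𝕜) • specProj A μ (resolvent A τ w) := by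
    rw [← h']; push_cast; rw [add_smul, one_smul]
  rw [e, smul_smul, ← RCLike.ofReal_mul, inv_mul_cancel₀ (by positivity), RCLike.ofReal_one,
    one_smul]

theorem specProj_coarse (hA : IsPosDefCompactInverse A) {ΔT : ℝ} (hΔT : 0 < ΔT) (t : ℝ) (v : H)
    (f : ℝ → H) {μ : ℝ} (hμ : 0 < μ) :
    specProj A μ (coarse A t ΔT v f) = (((1 + ΔT * μ)⁻¹ : ℝ) : 𝕜) •
      (specProj A μ v + (ΔT : 𝕜) • specProj A μ (f t)) := by
  rw [coarse, hA.specProj_resolvent hΔT _ hμ, map_add, map_smul]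

theorem specProj_fine (hA : IsPosDefCompactInverse A) {S : SingleStepScheme 𝕜} (h1 : S.P1)
    {Δt : ℝ} (hΔt : 0 < Δt) (t : ℝ) (v : H) (f : ℝ → H) (μ : ℝ) :
    specProj A μ (fine S A t Δt v f) = ratVal S.r (-(Δt * μ)) • specProj A μ v +
      (Δt : 𝕜) • ∑ i, ratVal (S.p i) (-(Δt * μ)) • specProj A μ (f (t + S.c i * Δt)) := by
  obtain ⟨B, hB⟩ := h1.norm_p_le
  rw [fine, map_add, map_smul, map_sum, hA.specProj_specMap (B := 1)
    fun μ hμ => (h1.norm_r_lt_one _ (mul_pos hΔt hμ)).le]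
  congr 2
  refine Finset.sum_congr rfl fun i _ => ?_
  rw [hA.specProj_specMap (B := B) fun μ hμ => hB i _ (mul_pos hΔt hμ)]

end IsPosDefCompactInverse

end Spectral

/-! ### Square sums of spectral components -/

theorem sum_sq_add_le {ι : Type*} {s : Finset ι} {a b : ι → ℝ} {α β : ℝ} (hα : 0 ≤ α)
    (hβ : 0 ≤ β) (ha : ∑ i ∈ s, a i ^ 2 ≤ α ^ 2) (hb : ∑ i ∈ s, b i ^ 2 ≤ β ^ 2) :
    ∑ i ∈ s, (a i + b i) ^ 2 ≤ (α + β) ^ 2 := by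
  have h1 := Finset.sum_mul_sq_le_sq_mul_sq s a b
  have h2 : ∑ i ∈ s, a i * b i ≤ α * β := by
    refine le_of_sq_le_sq (h1.trans ?_) (by positivity)
    rw [mul_pow]
    exact mul_le_mul ha hb (Finset.sum_nonneg fun _ _ => sq_nonneg _) (sq_nonneg _)
  have h3 : ∑ i ∈ s, (a i + b i) ^ 2
      = ∑ i ∈ s, a i ^ 2 + 2 * ∑ i ∈ s, a i * b i + ∑ i ∈ s, b i ^ 2 := by
    rw [Finset.mul_sum, ← Finset.sum_add_distrib, ← Finset.sum_add_distrib]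
    exact Finset.sum_congr rfl fun i _ => by ring
  rw [h3]; nlinarith

theorem sum_sq_mul_le {ι : Type*} {s : Finset ι} {a : ι → ℝ} {α : ℝ} (c : ℝ)
    (ha : ∑ i ∈ s, a i ^ 2 ≤ α ^ 2) : ∑ i ∈ s, (c * a i) ^ 2 ≤ (c * α) ^ 2 := by
  simp only [mul_pow]
  rw [← Finset.mul_sum]
  gcongr

section Components

variable {𝕜 H : Type*} [RCLike 𝕜] [NormedAddCommGroup H] [InnerProductSpace 𝕜 H]
  [CompleteSpace H] {A : H →ₗ.[𝕜] H}

theorem intervalIntegrable_norm_specProj {g : ℝ → H} {a b : ℝ}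
    (hg : IntervalIntegrable g MeasureTheory.volume a b) (μ : ℝ) :
    IntervalIntegrable (fun s => ‖specProj A μ (g s)‖) MeasureTheory.volume a b :=
  ⟨((specProj A μ).integrable_comp hg.1).norm, ((specProj A μ).integrable_comp hg.2).norm⟩

/-- Minkowski's integral inequality for the spectral components. -/
theorem IsPosDefCompactInverse.sum_sq_integral_le (hA : IsPosDefCompactInverse A) {g : ℝ → H}
    {T : ℝ} (hT : 0 ≤ T) (hg : IntervalIntegrable g MeasureTheory.volume 0 T) (s : Finset ℝ) :
    ∑ μ ∈ s, (∫ t in (0 : ℝ)..T, ‖specProj A μ (g t)‖) ^ 2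
      ≤ (∫ t in (0 : ℝ)..T, ‖g t‖) ^ 2 := by
  set c : ℝ → ℝ := fun μ => ∫ t in (0 : ℝ)..T, ‖specProj A μ (g t)‖ with hc
  set Q := ∑ μ ∈ s, c μ ^ 2 with hQ
  have hQ0 : 0 ≤ Q := Finset.sum_nonneg fun _ _ => sq_nonneg _
  have hi : ∀ μ ∈ s, IntervalIntegrable (fun t => c μ * ‖specProj A μ (g t)‖)
      MeasureTheory.volume 0 T := fun μ _ =>
    (intervalIntegrable_norm_specProj hg μ).const_mul (c μ)
  have h1 : Q = ∫ t in (0 : ℝ)..T, ∑ μ ∈ s, c μ * ‖specProj A μ (g t)‖ := by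
    rw [intervalIntegral.integral_finsetSum hi]
    refine Finset.sum_congr rfl fun μ _ => ?_
    rw [intervalIntegral.integral_const_mul, sq]
  have h2 : Q ≤ √Q * ∫ t in (0 : ℝ)..T, ‖g t‖ := by
    rw [← intervalIntegral.integral_const_mul]
    conv_lhs => rw [h1]
    refine intervalIntegral.integral_mono_on hT ?_ (hg.norm.const_mul _) fun t _ => ?_
    · exact ⟨MeasureTheory.integrable_finsetSum s fun μ hμ => (hi μ hμ).1,
        MeasureTheory.integrable_finsetSum s fun μ hμ => (hi μ hμ).2⟩
    -- Cauchy–Schwarz over the modes, then Bessel at fixed `t`. Dividing by `√Q` afterwards gives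
    -- the claim.
    · refine le_of_sq_le_sq ((Finset.sum_mul_sq_le_sq_mul_sq s _ _).trans ?_) (by positivity)
      rw [mul_pow, Real.sq_sqrt hQ0]
      exact mul_le_mul_of_nonneg_left (hA.sum_norm_sq_specProj_le _ s) hQ0
  have h3 : 0 ≤ ∫ t in (0 : ℝ)..T, ‖g t‖ :=
    intervalIntegral.integral_nonneg hT fun _ _ => norm_nonneg _
  rcases hQ0.eq_or_lt with h | h
  · rw [← h]; positivity
  · have h4 : √Q ≤ ∫ t in (0 : ℝ)..T, ‖g t‖ := by
      have h5 : 0 < √Q := Real.sqrt_pos.2 h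
      have h6 : √Q * √Q = Q := Real.mul_self_sqrt hQ0
      refine le_of_mul_le_mul_left ?_ h5
      rwa [h6]
    exact (Real.sqrt_le_left h3).1 h4

end Components

/-! ### Properties of the source term -/

section Source

variable {𝕜 H : Type*} [RCLike 𝕜] [NormedAddCommGroup H] [InnerProductSpace 𝕜 H]
  {A : H →ₗ.[𝕜] H}

/-- Regularity gives continuity of the highest power `A^q f` only; applying `K` to it `q - 1` times
recovers continuity of `A f`. -/
theorem iterate_inverse_iterate_app {K : H →L[𝕜] H} (hK : ∀ x : A.domain, K (A x) = x) (k : ℕ) :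
    ∀ x ∈ powDomain A (k + 1), K^[k] ((app A)^[k + 1] x) = app A x := by
  induction k with
  | zero => intro x _; rfl
  | succ k ih =>
    intro x hx
    have hd : (app A)^[k + 1] x ∈ A.domain := hx (k + 1) (by omega)
    have e : K (app A ((app A)^[k + 1] x)) = (app A)^[k + 1] x := by
      rw [app, dif_pos hd]; exact hK ⟨_, hd⟩
    rw [Function.iterate_succ_apply, Function.iterate_succ_apply' (app A), e]
    exact ih x fun i hi => hx i (by omega)

variable [NormedSpace ℝ H] {T : ℝ} {q : ℕ} {f : ℝ → H} {df : ℕ → ℝ → H}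

namespace SourceRegularity

theorem mem_domain (hf : SourceRegularity A T q f df) (hq : 1 ≤ q) {t : ℝ}
    (ht : t ∈ Set.Icc 0 T) : f t ∈ A.domain := by
  rw [← hf.zero_eq t ht]
  exact hf.mem_powDomain 0 hq t ht 0 (by omega)

theorem intervalIntegrable_deriv (hf : SourceRegularity A T q f df) (hq : 1 ≤ q) (hT : 0 ≤ T) :
    IntervalIntegrable (df 1) MeasureTheory.volume 0 T := by
  rcases hq.eq_or_lt with rfl | h
  · exact hf.integrable_top
  · exact (hf.continuousOn 1 h).intervalIntegrable_of_Icc hT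

variable [CompleteSpace H]

theorem continuousOn_app (hA : IsPosDefCompactInverse A) (hf : SourceRegularity A T q f df)
    (hq : 1 ≤ q) : ContinuousOn (fun t => app A (f t)) (Set.Icc 0 T) := by
  obtain ⟨K, -, -, hK⟩ := hA.compact_inverse
  obtain ⟨k, rfl⟩ : ∃ k, q = k + 1 := ⟨q - 1, by omega⟩
  have h := (K.continuous.iterate k).comp_continuousOn (hf.continuousOn_pow 0 (by omega))
  refine h.congr fun t ht => ?_
  rw [← hf.zero_eq t ht]
  exact (iterate_inverse_iterate_app hK k _ (hf.mem_powDomain 0 (by omega) t ht)).symm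

/-- Continuity makes the set bounded above, without which the real `sSup` would be 0. -/
theorem norm_app_le (hA : IsPosDefCompactInverse A) (hf : SourceRegularity A T q f df)
    (hq : 1 ≤ q) {t : ℝ} (ht : t ∈ Set.Icc 0 T) :
    ‖app A (f t)‖ ≤ sSup ((fun s => ‖app A (f s)‖) '' Set.Icc 0 T) :=
  le_csSup (isCompact_Icc.bddAbove_image (hf.continuousOn_app hA hq).norm) ⟨t, ht, rfl⟩

theorem norm_specProj_sub_le [IsScalarTower ℝ 𝕜 H] (hf : SourceRegularity A T q f df)
    (hq : 1 ≤ q) (μ : ℝ) {t : ℝ} (ht : t ∈ Set.Icc 0 T) :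
    ‖specProj A μ (f t) - specProj A μ (f 0)‖ ≤ ∫ s in (0 : ℝ)..T, ‖specProj A μ (df 1 s)‖ := by
  have hT : 0 ≤ T := ht.1.trans ht.2
  have hi := hf.intervalIntegrable_deriv hq hT
  have hsub : Set.uIcc 0 t ⊆ Set.uIcc 0 T := by
    rw [Set.uIcc_of_le ht.1, Set.uIcc_of_le hT]
    exact Set.Icc_subset_Icc_right ht.2
  have e : f t - f 0 = ∫ s in (0 : ℝ)..t, df 1 s := by
    rw [← hf.zero_eq t ht, ← hf.zero_eq 0 ⟨le_rfl, hT⟩, hf.eq_integral 0 hq t ht,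
      add_sub_cancel_left]
  rw [← map_sub, e]
  have e2 := ((specProj A μ).restrictScalars ℝ).intervalIntegral_comp_comm (hi.mono_set hsub)
  rw [ContinuousLinearMap.coe_restrictScalars'] at e2
  rw [← e2]
  refine (intervalIntegral.norm_integral_le_integral_norm ht.1).trans ?_
  refine intervalIntegral.integral_mono_interval le_rfl ht.1 ht.2
    (Filter.Eventually.of_forall fun _ => norm_nonneg _) ?_
  exact intervalIntegrable_norm_specProj hi μ

end SourceRegularity

end Source

/-! ### The parareal error on one eigenspace -/

section Modes

variable {𝕜 H : Type*} [RCLike 𝕜] [NormedAddCommGroup H] [InnerProductSpace 𝕜 H]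
  [CompleteSpace H] {A : H →ₗ.[𝕜] H} {S : SingleStepScheme 𝕜}

theorem timeStepping_mul_add (Δt : ℝ) (u₀ : H) (f : ℝ → H) (n J j : ℕ) :
    timeStepping S A Δt u₀ f (n * J + j)
      = fineInner S A (n * (J * Δt)) Δt (timeStepping S A Δt u₀ f (n * J)) f j := by
  induction j with
  | zero => rfl
  | succ j ih =>
    rw [← add_assoc, timeStepping, fineInner, ih]
    congr 1
    push_cast; ring

/-- The fine propagator is affine in the state, so the source drops out of differences. -/
theorem IsPosDefCompactInverse.specProj_fineInner_sub (hA : IsPosDefCompactInverse A)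
    (h1 : S.P1) {Δt : ℝ} (hΔt : 0 < Δt) (t : ℝ) (v w : H) (f : ℝ → H) (μ : ℝ) (j : ℕ) :
    specProj A μ (fineInner S A t Δt v f j - fineInner S A t Δt w f j)
      = ratVal S.r (-(Δt * μ)) ^ j • specProj A μ (v - w) := by
  induction j with
  | zero => simp [fineInner]
  | succ j ih =>
    rw [fineInner, fineInner, map_sub, hA.specProj_fine h1 hΔt, hA.specProj_fine h1 hΔt,
      add_sub_add_right_eq_sub, ← smul_sub, ← map_sub, ih, smul_smul, pow_succ']

/-- The fine solution restarts on each coarse interval, so it is a fixed point of the sweep and only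
differences of propagators remain. -/
theorem IsPosDefCompactInverse.specProj_error_succ (hA : IsPosDefCompactInverse A) (h1 : S.P1)
    {Δt : ℝ} (hΔt : 0 < Δt) {J : ℕ} (hJ : 0 < J) (u₀ : H) (f : ℝ → H) {μ : ℝ} (hμ : 0 < μ)
    (k n : ℕ) :
    specProj A μ (parareal S A J Δt u₀ f (k + 1) (n + 1)
        - timeStepping S A Δt u₀ f ((n + 1) * J))
      = (((1 + J * (Δt * μ))⁻¹ : ℝ) : 𝕜) • specProj A μ
          (parareal S A J Δt u₀ f (k + 1) n - timeStepping S A Δt u₀ f (n * J))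
        + (ratVal S.r (-(Δt * μ)) ^ J - (((1 + J * (Δt * μ))⁻¹ : ℝ) : 𝕜)) • specProj A μ
          (parareal S A J Δt u₀ f k n - timeStepping S A Δt u₀ f (n * J)) := by
  have hΔT : 0 < J * Δt := by positivity
  have e : parareal S A J Δt u₀ f (k + 1) (n + 1) =
      coarse A (n * (J * Δt)) (J * Δt) (parareal S A J Δt u₀ f (k + 1) n) f
        + fineInner S A (n * (J * Δt)) Δt (parareal S A J Δt u₀ f k n) f J
        - coarse A (n * (J * Δt)) (J * Δt) (parareal S A J Δt u₀ f k n) f := rfl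
  rw [e, add_mul, one_mul, timeStepping_mul_add]
  set u := timeStepping S A Δt u₀ f (n * J)
  have h := hA.specProj_fineInner_sub h1 hΔt (n * (J * Δt)) (parareal S A J Δt u₀ f k n) u f μ J
  have e2 : ∀ a b c d : H, a + b - c - d = (a - c) + (b - d) := fun a b c d => by abel
  rw [e2, map_add, h, map_sub, hA.specProj_coarse hΔT _ _ _ hμ, hA.specProj_coarse hΔT _ _ _ hμ,
    mul_assoc, ← smul_sub, add_sub_add_right_eq_sub, map_sub, map_sub]
  module

theorem IsPosDefCompactInverse.norm_specProj_error_le (hA : IsPosDefCompactInverse A)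
    (h1 : S.P1) {Δt : ℝ} (hΔt : 0 < Δt) {J : ℕ} (hJ : 0 < J) (u₀ : H) (f : ℝ → H) {μ : ℝ}
    (hμ : 0 < μ)
    (hcontr : ‖ratVal S.r (-(Δt * μ)) ^ J - (((1 + J * (Δt * μ))⁻¹ : ℝ) : 𝕜)‖
      ≤ 0.3 * (J * (Δt * μ) / (1 + J * (Δt * μ)))) {Nc : ℕ} {M : ℝ}
    (h0 : ∀ n ≤ Nc, ‖specProj A μ (parareal S A J Δt u₀ f 0 n
      - timeStepping S A Δt u₀ f (n * J))‖ ≤ M) (k : ℕ) :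
    ∀ n ≤ Nc, ‖specProj A μ (parareal S A J Δt u₀ f k n
      - timeStepping S A Δt u₀ f (n * J))‖ ≤ M * 0.3 ^ k := by
  have hM : 0 ≤ M := (norm_nonneg _).trans (h0 0 (Nat.zero_le _))
  induction k with
  | zero => simpa using h0
  | succ k ih =>
    -- The inner induction over `n` uses the previous iterate through `ih` and the current one
    -- through `ihn`, with weights `(1 + z)⁻¹` and `z / (1 + z)` summing to 1.
    intro n
    induction n with
    | zero =>
      intro _
      have e : parareal S A J Δt u₀ f (k + 1) 0 - timeStepping S A Δt u₀ f (0 * J) = 0 := by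
        simp [parareal, sweep, timeStepping]
      rw [e, map_zero, norm_zero]; positivity
    | succ n ihn =>
      intro hn
      have a1 := ihn (by omega)
      have a2 := ih n (by omega)
      set z : ℝ := J * (Δt * μ) with hz
      have hz0 : 0 < z := by positivity
      have hR : 0 ≤ (1 + z)⁻¹ := by positivity
      rw [hA.specProj_error_succ h1 hΔt hJ u₀ f hμ]
      refine (norm_add_le _ _).trans ?_
      rw [norm_smul, norm_smul, RCLike.norm_ofReal, abs_of_nonneg hR]
      calc _ ≤ (1 + z)⁻¹ * (M * 0.3 ^ (k + 1)) + 0.3 * (z / (1 + z)) * (M * 0.3 ^ k) := by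
            gcongr
        _ = M * 0.3 ^ (k + 1) := by field_simp; ring

/-- The ramp `t_n f_μ(0)` almost solves the recursion: one step leaves the defect `(1 - R) t_{n+1}
f_μ(0)`, with `1 - R ≤ ΔT μ`, and the variation of `f_μ`. Both are of size `ΔT`, and stability sums
them. -/
theorem IsPosDefCompactInverse.norm_specProj_initialGuess_sub_le (hA : IsPosDefCompactInverse A)
    {ΔT T : ℝ} (hΔT : 0 < ΔT) (u₀ : H) (f : ℝ → H) {μ : ℝ} (hμ : 0 < μ) {I : ℝ}
    (hI : ∀ t ∈ Set.Icc 0 T, ‖specProj A μ (f t) - specProj A μ (f 0)‖ ≤ I) (n : ℕ)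
    (hn : n * ΔT ≤ T) :
    ‖specProj A μ (initialGuess A ΔT u₀ f n)
        - ((((1 + ΔT * μ)⁻¹ : ℝ) : 𝕜) ^ n • specProj A μ u₀
          + ((n * ΔT : ℝ) : 𝕜) • specProj A μ (f 0))‖
      ≤ n * ΔT * (T * (μ * ‖specProj A μ (f 0)‖) + I) := by
  induction n with
  | zero => simp [initialGuess]
  | succ n ih =>
    have hn' : n * ΔT ≤ T := by push_cast at hn; linarith
    have a1 := ih hn'
    have a2 := hI (n * ΔT) ⟨by positivity, hn'⟩
    have hT : 0 ≤ T := le_trans (by positivity) hn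
    set R : ℝ := (1 + ΔT * μ)⁻¹ with hR
    have hR0 : 0 ≤ R := by positivity
    have hR1 : R ≤ 1 := inv_le_one_of_one_le₀ (by nlinarith [mul_pos hΔT hμ])
    have hR2 : 1 - R ≤ ΔT * μ := by
      have h : 0 < ΔT * μ := mul_pos hΔT hμ
      have : R * (1 + ΔT * μ) = 1 := inv_mul_cancel₀ (by positivity)
      nlinarith
    set F := specProj A μ (f 0)
    rw [initialGuess, hA.specProj_coarse hΔT _ _ _ hμ]
    set U := specProj A μ (initialGuess A ΔT u₀ f n)
    set u := specProj A μ u₀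
    have e : (R : 𝕜) • (U + (ΔT : 𝕜) • specProj A μ (f (n * ΔT)))
        - ((R : 𝕜) ^ (n + 1) • u + (((n + 1 : ℕ) * ΔT : ℝ) : 𝕜) • F)
        = (R : 𝕜) • (U - ((R : 𝕜) ^ n • u + ((n * ΔT : ℝ) : 𝕜) • F))
          + ((R * ΔT : ℝ) : 𝕜) • (specProj A μ (f (n * ΔT)) - F)
          - (((1 - R) * ((n + 1 : ℕ) * ΔT) : ℝ) : 𝕜) • F := by
      push_cast; module
    rw [e]
    refine (norm_sub_le _ _).trans ((add_le_add (norm_add_le _ _) le_rfl).trans ?_)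
    rw [norm_smul, norm_smul, norm_smul, RCLike.norm_ofReal, RCLike.norm_ofReal,
      RCLike.norm_ofReal, abs_of_nonneg hR0, abs_of_nonneg (by positivity : 0 ≤ R * ΔT),
      abs_of_nonneg (mul_nonneg (by linarith) (by positivity))]
    calc _ ≤ 1 * (n * ΔT * (T * (μ * ‖F‖) + I)) + (1 * ΔT) * I + (ΔT * μ * T) * ‖F‖ := by
          have := (norm_nonneg _).trans a2
          gcongr
      _ = _ := by push_cast; ring

/-- The same ramp works for the fine scheme: the defects `(r - 1) t_n f_μ(0)` and `Δt (∑ p_i - 1)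
f_μ(0)` each gain a factor `Δt μ` by consistency. -/
theorem IsPosDefCompactInverse.norm_specProj_timeStepping_sub_le
    (hA : IsPosDefCompactInverse A) (h1 : S.P1) {B Cr Cp : ℝ} (hB0 : 0 ≤ B)
    (hB : ∀ i, ∀ x : ℝ, 0 < x → ‖ratVal (S.p i) (-x)‖ ≤ B)
    (hCr : ∀ x : ℝ, 0 < x → ‖ratVal S.r (-x) - 1‖ ≤ Cr * x)
    (hCp : ∀ x : ℝ, 0 < x → ‖(∑ i, ratVal (S.p i) (-x)) - 1‖ ≤ Cp * x)
    {Δt T : ℝ} (hΔt : 0 < Δt) (u₀ : H) (f : ℝ → H) {μ : ℝ} (hμ : 0 < μ) {I : ℝ}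
    (hI : ∀ t ∈ Set.Icc 0 T, ‖specProj A μ (f t) - specProj A μ (f 0)‖ ≤ I) (n : ℕ)
    (hn : n * Δt ≤ T) :
    ‖specProj A μ (timeStepping S A Δt u₀ f n)
        - (ratVal S.r (-(Δt * μ)) ^ n • specProj A μ u₀
          + ((n * Δt : ℝ) : 𝕜) • specProj A μ (f 0))‖
      ≤ n * Δt * ((Cr + Cp) * (T * (μ * ‖specProj A μ (f 0)‖)) + S.m * B * I) := by
  induction n with
  | zero => simp [timeStepping]
  | succ n ih =>
    have hn1 : n * Δt + Δt ≤ T := by push_cast at hn; linarith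
    have hn' : n * Δt ≤ T := by linarith
    have hn0 : 0 ≤ n * Δt := by positivity
    have hT : Δt ≤ T := by linarith
    have hT0 : 0 ≤ T := hΔt.le.trans hT
    have hx : 0 < Δt * μ := mul_pos hΔt hμ
    have a1 := ih hn'
    have a2 : ∀ i, ‖specProj A μ (f (n * Δt + S.c i * Δt)) - specProj A μ (f 0)‖ ≤ I := by
      intro i
      have hc := S.c_mem i
      refine hI _ ⟨add_nonneg hn0 (mul_nonneg hc.1 hΔt.le), ?_⟩
      nlinarith [hc.2]
    have b1 := (h1.norm_r_lt_one _ hx).le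
    have b2 := hCr _ hx
    have b3 := hCp _ hx
    rw [timeStepping, hA.specProj_fine h1 hΔt]
    set r := ratVal S.r (-(Δt * μ))
    set p := fun i => ratVal (S.p i) (-(Δt * μ))
    set F := specProj A μ (f 0)
    set U := specProj A μ (timeStepping S A Δt u₀ f n)
    set u := specProj A μ u₀
    set G := fun i => specProj A μ (f (n * Δt + S.c i * Δt))
    have b4 : ‖∑ i, p i • (G i - F)‖ ≤ S.m * B * I := by
      refine (norm_sum_le _ _).trans ?_
      have : ∀ i ∈ Finset.univ, ‖p i • (G i - F)‖ ≤ B * I := fun i _ => by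
        rw [norm_smul]
        exact mul_le_mul (hB i _ hx) (a2 i) (norm_nonneg _) hB0
      refine (Finset.sum_le_sum this).trans (le_of_eq ?_)
      simp; ring
    have e0 : ∑ i, p i • G i = ∑ i, p i • (G i - F) + (∑ i, p i) • F := by
      simp only [smul_sub, Finset.sum_sub_distrib, Finset.sum_smul, sub_add_cancel]
    have e : r • U + (Δt : 𝕜) • ∑ i, p i • G i
        - (r ^ (n + 1) • u + (((n + 1 : ℕ) * Δt : ℝ) : 𝕜) • F)
        = r • (U - (r ^ n • u + ((n * Δt : ℝ) : 𝕜) • F))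
          + (Δt : 𝕜) • ∑ i, p i • (G i - F)
          + ((r - 1) * ((n * Δt : ℝ) : 𝕜)) • F
          + ((Δt : 𝕜) * (∑ i, p i - 1)) • F := by
      rw [e0]; push_cast; module
    change ‖r • U + (Δt : 𝕜) • ∑ i, p i • G i - _‖ ≤ _
    rw [e]
    refine (norm_add₄_le).trans ?_
    rw [norm_smul, norm_smul, norm_smul, norm_smul, norm_mul, norm_mul, RCLike.norm_ofReal,
      RCLike.norm_ofReal, abs_of_nonneg hΔt.le, abs_of_nonneg hn0]
    have hCrx : 0 ≤ Cr * (Δt * μ) := (norm_nonneg _).trans b2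
    have hCpx : 0 ≤ Cp * (Δt * μ) := (norm_nonneg _).trans b3
    calc _ ≤ 1 * (n * Δt * ((Cr + Cp) * (T * (μ * ‖F‖)) + S.m * B * I)) + Δt * (S.m * B * I)
          + Cr * (Δt * μ) * T * ‖F‖ + T * (Cp * (Δt * μ)) * ‖F‖ := by
          gcongr
      _ = _ := by push_cast; ring

end Modes

theorem IsPosDefCompactInverse.norm_specProj_initial_error_le {𝕜 H : Type*} [RCLike 𝕜]
    [NormedAddCommGroup H] [InnerProductSpace 𝕜 H] [CompleteSpace H] {A : H →ₗ.[𝕜] H}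
    {S : SingleStepScheme 𝕜} (hA : IsPosDefCompactInverse A) (h1 : S.P1) {B Cr Cp : ℝ}
    (hB0 : 0 ≤ B) (hCr0 : 0 ≤ Cr) (hCp0 : 0 ≤ Cp)
    (hB : ∀ i, ∀ x : ℝ, 0 < x → ‖ratVal (S.p i) (-x)‖ ≤ B)
    (hCr : ∀ x : ℝ, 0 < x → ‖ratVal S.r (-x) - 1‖ ≤ Cr * x)
    (hCp : ∀ x : ℝ, 0 < x → ‖(∑ i, ratVal (S.p i) (-x)) - 1‖ ≤ Cp * x)
    {Δt T : ℝ} (hΔt : 0 < Δt) {J : ℕ} (hJ : 0 < J) (u₀ : H) (f : ℝ → H) {μ : ℝ} (hμ : 0 < μ)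
    {I : ℝ} (hI0 : 0 ≤ I)
    (hI : ∀ t ∈ Set.Icc 0 T, ‖specProj A μ (f t) - specProj A μ (f 0)‖ ≤ I) (n : ℕ)
    (hn : n * (J * Δt) ≤ T) :
    ‖specProj A μ (parareal S A J Δt u₀ f 0 n - timeStepping S A Δt u₀ f (n * J))‖
      ≤ (2 + Cr + Cp + S.m * B) *
        (‖specProj A μ u₀‖ + T * (T * (μ * ‖specProj A μ (f 0)‖) + I)) := by
  have hT : 0 ≤ T := le_trans (by positivity) hn
  have hn' : ((n * J : ℕ) : ℝ) * Δt = n * (J * Δt) := by push_cast; ring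
  have a1 := hA.norm_specProj_initialGuess_sub_le (by positivity : 0 < J * Δt) u₀ f hμ hI n hn
  have a2 := hA.norm_specProj_timeStepping_sub_le h1 hB0 hB hCr hCp hΔt u₀ f hμ hI (n * J)
    (hn'.trans_le hn)
  rw [hn'] at a2
  set F := specProj A μ (f 0)
  set u := specProj A μ u₀
  set R : ℝ := (1 + J * Δt * μ)⁻¹ with hR
  set r := ratVal S.r (-(Δt * μ))
  have hR0 : 0 ≤ R := by positivity
  have hR1 : R ≤ 1 := inv_le_one_of_one_le₀ (by
    have : 0 ≤ J * Δt * μ := by positivity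
    linarith)
  have hr : ‖r‖ ≤ 1 := (h1.norm_r_lt_one _ (mul_pos hΔt hμ)).le
  have b1 : ‖((R : 𝕜) ^ n - r ^ (n * J)) • u‖ ≤ 2 * ‖u‖ := by
    rw [norm_smul]
    refine mul_le_mul_of_nonneg_right ((norm_sub_le _ _).trans ?_) (norm_nonneg _)
    rw [norm_pow, norm_pow, RCLike.norm_ofReal, abs_of_nonneg hR0]
    have c1 := pow_le_one₀ (n := n) hR0 hR1
    have c2 := pow_le_one₀ (n := n * J) (norm_nonneg r) hr
    linarith
  change ‖specProj A μ (initialGuess A (J * Δt) u₀ f n - _)‖ ≤ _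
  rw [map_sub]
  set U := specProj A μ (initialGuess A (J * Δt) u₀ f n)
  set V := specProj A μ (timeStepping S A Δt u₀ f (n * J))
  set w := ((n * (J * Δt) : ℝ) : 𝕜) • F
  -- The ramp `w` is common to both trajectories since they are taken at the same time, and it
  -- cancels.
  have e : U - V = (U - ((R : 𝕜) ^ n • u + w)) - (V - (r ^ (n * J) • u + w))
      + ((R : 𝕜) ^ n - r ^ (n * J)) • u := by
    rw [sub_smul]; abel
  rw [e]
  refine (norm_add_le _ _).trans ((add_le_add ((norm_sub_le _ _).trans (add_le_add a1 a2))
    b1).trans ?_)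
  set X := T * (μ * ‖F‖) with hX
  have hX0 : 0 ≤ X := by positivity
  have hmB : 0 ≤ S.m * B := by positivity
  have hu : 0 ≤ ‖u‖ := norm_nonneg u
  calc _ ≤ T * (X + I) + T * ((Cr + Cp) * X + S.m * B * I) + 2 * ‖u‖ := by gcongr
    _ ≤ _ := by
      have d1 : 0 ≤ (Cr + Cp + S.m * B) * ‖u‖ := by positivity
      have d2 : 0 ≤ T * ((1 + S.m * B) * X) := by positivity
      have d3 : 0 ≤ T * ((1 + Cr + Cp) * I) := by positivity
      nlinarith

end Parareal

end

/-- The threshold `Jstar` and the constant `C` depend on the fine integrator only: not on the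
Hilbert space, the operator, the data, the final time or the step sizes. -/
theorem theorem3p4 {𝕜 : Type*} [RCLike 𝕜] (S : Parareal.SingleStepScheme 𝕜) (q : ℕ)
    (hq : 1 ≤ q) (h1 : S.P1) (h2 : S.P2 q) (h3 : S.P3) :
    ∃ Jstar : ℕ, 0 < Jstar ∧ ∃ C : ℝ, 0 < C ∧
      ∀ (H : Type*) [NormedAddCommGroup H] [InnerProductSpace 𝕜 H] [CompleteSpace H]
        [NormedSpace ℝ H] [IsScalarTower ℝ 𝕜 H] (A : H →ₗ.[𝕜] H),
        Parareal.IsPosDefCompactInverse A →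
      ∀ (T : ℝ), 0 < T → ∀ (u₀ : H) (f : ℝ → H) (df : ℕ → ℝ → H),
        Parareal.SourceRegularity A T q f df →
      ∀ (J : ℕ), 2 ≤ J → Jstar ≤ J → ∀ (Nc : ℕ), 1 ≤ Nc →
      ∀ (Δt : ℝ), Δt = T / (Nc * J) →
      ∀ (k n : ℕ), 1 ≤ n → n ≤ Nc →
        ‖Parareal.parareal S A J Δt u₀ f k n - Parareal.timeStepping S A Δt u₀ f (n * J)‖
          ≤ C * Parareal.dataSize A T u₀ f (df 1) * (0.3 : ℝ) ^ k := by
  obtain ⟨Jstar, hJstar, hcontr⟩ := S.exists_contraction hq h1 h2 h3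
  obtain ⟨B', hB'⟩ := h1.norm_p_le
  obtain ⟨Cr, hCr0, hCr⟩ := S.exists_norm_r_sub_one_le hq h1 h2
  obtain ⟨Cp, hCp0, hCp⟩ := S.exists_norm_sum_p_sub_one_le hq h1 h2
  set B := max B' 0
  have hB0 : 0 ≤ B := le_max_right _ _
  have hB : ∀ i, ∀ x : ℝ, 0 < x → ‖Parareal.ratVal (S.p i) (-x)‖ ≤ B :=
    fun i x hx => (hB' i x hx).trans (le_max_left _ _)
  refine ⟨Jstar, hJstar, 2 + Cr + Cp + S.m * B, by positivity, ?_⟩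
  intro H _ _ _ _ _ A hA T hT u₀ f df hf J hJ2 hJ Nc hNc Δt hΔt k n _ hn
  set C := 2 + Cr + Cp + S.m * B with hC
  have hC0 : 0 ≤ C := by positivity
  have hJ0 : 0 < J := by omega
  have hΔt0 : 0 < Δt := by rw [hΔt]; positivity
  have hTNc : Nc * (J * Δt) = T := by rw [hΔt]; field_simp
  have h0T : (0 : ℝ) ∈ Set.Icc 0 T := ⟨le_rfl, hT.le⟩
  have hi := hf.intervalIntegrable_deriv hq hT.le
  set I : ℝ → ℝ := fun μ => ∫ s in (0 : ℝ)..T, ‖Parareal.specProj A μ (df 1 s)‖ with hI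
  have hI0 : ∀ μ, 0 ≤ I μ :=
    fun μ => intervalIntegral.integral_nonneg hT.le fun _ _ => norm_nonneg _
  set Af := Parareal.app A (f 0) with hAf
  have hfd := hf.mem_domain hq h0T
  have hAfμ : ∀ μ : ℝ, 0 < μ → ‖Parareal.specProj A μ Af‖ = μ * ‖Parareal.specProj A μ (f 0)‖ := by
    intro μ hμ
    rw [hAf, Parareal.app, dif_pos hfd, hA.specProj_map, norm_smul, RCLike.norm_ofReal,
      abs_of_pos hμ]
  set L : ℝ := ∫ s in (0 : ℝ)..T, ‖df 1 s‖ with hL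
  have hL0 : 0 ≤ L := intervalIntegral.integral_nonneg hT.le fun _ _ => norm_nonneg _
  set D := ‖u₀‖ + T * (T * ‖Af‖ + L) with hD
  have hDle : D ≤ Parareal.dataSize A T u₀ f (df 1) := by
    rw [hD, Parareal.dataSize]
    gcongr
    exact hf.norm_app_le hA hq h0T
  have hmode : ∀ μ : ℝ, ‖Parareal.specProj A μ (Parareal.parareal S A J Δt u₀ f k n
      - Parareal.timeStepping S A Δt u₀ f (n * J))‖ ≤ (C * 0.3 ^ k) *
        (‖Parareal.specProj A μ u₀‖ + T * (T * ‖Parareal.specProj A μ Af‖ + I μ)) := by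
    intro μ
    -- The projections are indexed by all real `μ`; those with `μ ≤ 0` vanish.
    rcases le_or_gt μ 0 with hμ | hμ
    · rw [hA.specProj_eq_zero hμ, norm_zero]
      have := hI0 μ
      positivity
    · rw [hAfμ μ hμ, mul_right_comm]
      refine hA.norm_specProj_error_le h1 hΔt0 hJ0 u₀ f hμ
        (hcontr J hJ2 hJ _ (mul_pos hΔt0 hμ)) (Nc := Nc) (fun j hj => ?_) k n hn
      refine hA.norm_specProj_initial_error_le h1 hB0 hCr0 hCp0 hB hCr hCp hΔt0 hJ0 u₀ f hμ
        (hI0 μ) (fun t ht => hf.norm_specProj_sub_le hq μ ht) j ?_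
      rw [← hTNc]
      gcongr
  have key : ‖Parareal.parareal S A J Δt u₀ f k n - Parareal.timeStepping S A Δt u₀ f (n * J)‖
      ≤ (C * 0.3 ^ k) * D := by
    -- The modewise bound has the structure of `D`, so square sums are taken term by term: Bessel
    -- for `u₀` and `A f(0)`, Minkowski for the integral.
    refine hA.norm_le_of_sum_le (by positivity) fun s => ?_
    refine (Finset.sum_le_sum fun μ _ => pow_le_pow_left₀ (norm_nonneg _) (hmode μ) 2).trans ?_
    refine Parareal.sum_sq_mul_le _ (Parareal.sum_sq_add_le (norm_nonneg _) (by positivity)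
      (hA.sum_norm_sq_specProj_le u₀ s) (Parareal.sum_sq_mul_le T
      (Parareal.sum_sq_add_le (by positivity) hL0 (Parareal.sum_sq_mul_le T
      (hA.sum_norm_sq_specProj_le Af s)) (hA.sum_sq_integral_le hT.le hi s))))
  refine key.trans ?_
  rw [mul_right_comm]
  gcongr
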